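/- Let $n\ge 2$. For an $(n+1)\times(n+1)$ matrix $A=(a_{ij})_{i,j=0}^n$ with entries in $\mathbb{Z}_{\ge 0}$ put $F_A=\sum_{i=0}^n\prod_{j=0}^n x_j^{a_{ij}}$. Let $A$ and $A'$ be two such matrices, each satisfying: the matrix is invertible over $\mathbb{Q}$; the polynomial is quasihomogeneous, i.e. there are positive integers $q_j,\delta$ with $\sum_j a_{ij}q_j=\delta$ for all $i$; and the zero set of the polynomial in $\mathbb{C}^{n+1}$ has exactly one singular point, the origin. Let $d,d'$ be positive integers such that $B:=dA^{-1}$ and $B':=d'(A')^{-1}$ have integer entries. Set $q_i=\sum_j b_{ij}$ and $r_j=\sum_i b_{ij}$, assume the Calabi-Yau condition $\sum_i q_i=d$, and let $X_A=\{F_A=0\}\subset W\mathbb{P}^n(q_0,\dots,q_n)$ and $X_{A^T}=\{F_{A^T}=0\}\subset W\mathbb{P}^n(r_0,\dots,r_n)$. Let $\mathrm{Aut}(F_A)$ be the group of all $\lambda\in(\mathbb{C}^*)^{n+1}$ with $F_A(\lambda_0x_0,\dots,\lambda_nx_n)=F_A(x_0,\dots,x_n)$ for all $x$, let $SL(F_A)=\{\lambda\in\mathrm{Aut}(F_A):\prod_j\lambda_j=1\}$,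 and let $J_{F_A}$ be the intersection of $\mathrm{Aut}(F_A)$ with the subgroup $\{(\mu^{q_0},\dots,\mu^{q_n}):\mu\in\mathbb{C}^*\}$; define $\mathrm{Aut}(F_{A^T})$ and $J_{F_{A^T}}$ in the same way with $A^T$ and the weights $r_j$. Let $G$ be a group with $J_{F_A}\subseteq G\subseteq SL(F_A)$. With $\rho_i^T=(e^{2\pi i\, b_{ij}/d})_{j=0}^n$, the dual group is $$G^T=\Big\{\prod_{i=0}^n(\rho_i^T)^{s_i}\ :\ s\in\mathbb{Z}^{n+1},\ \prod_{i=0}^n x_i^{s_i}\text{ is }G\text{-invariant}\Big\}.$$ Put $Z_{A,G}=X_A/(G/J_{F_A})$ and $Z_{A^T,G^T}=X_{A^T}/(G^T/J_{F_{A^T}})$. Make the same assumption and the same definitions for $A',B',d'$ and a group $G'$ with $J_{F_{A'}}\subseteq G'\subseteq SL(F_{A'})$. Let $X_{dd'I}=\{\sum_{i=0}^n y_i^{dd'}=0\}\subset\mathbb{P}^n$, let $\mathrm{Aut}(F_{dd'I})$ be the group of diagonal automorphisms of $F_{dd'I}=\sum_i y_i^{dd'}$, and let $J=J_{F_{dd'I}}$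 be its intersection with the scalars $\{(\mu,\dots,\mu)\}$. For an integer matrix $M=(m_{jk})_{j,k=0}^n$ let $\phi_M$ be the Shioda map $x_j=\prod_k y_k^{m_{jk}}$ and $(\phi_M)_*$ the map $(g_k)_k\mapsto(\prod_k g_k^{m_{jk}})_j$ on diagonal automorphisms. Define $$H=(\phi_{d'B})_*^{-1}(G)\subseteq\mathrm{Aut}(F_{dd'I}),\qquad H'=(\phi_{dB'})_*^{-1}(G')\subseteq\mathrm{Aut}(F_{dd'I}).$$ Let $\mathrm{pr}:\mathbb{Z}^{n+1}\to\mathrm{Aut}(F_{dd'I})$ be $\mathrm{pr}(h)=(e^{2\pi i\,h_j/(dd')})_j$, and for a subgroup $K\subseteq\mathrm{Aut}(F_{dd'I})$ let $$K^{\perp_M}=\mathrm{pr}\big(\{s\in\mathbb{Z}^{n+1}: s^TMh\in dd'\,\mathbb{Z}\text{ for all }h\in\mathrm{pr}^{-1}(K)\}\big).$$ Then there are birational equivalences of complex varieties $$Z_{A,G}\simeq X_{dd'I}/(H/J),\qquad Z_{A^T,G^T}\simeq X_{dd'I}/(H^{\perp_{d'B}}/J),$$ $$Z_{A',G'}\simeq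 X_{dd'I}/(H'/J),\qquad Z_{(A')^T,(G')^T}\simeq X_{dd'I}/((H')^{\perp_{dB'}}/J).$$ -/

import Mathlib

noncomputable section

open MvPolynomial
open scoped Topology

/-! ### Spaces with functions

Complex varieties are treated in the classical way, as topological spaces `X` (with the Zariski
topology) together with a sheaf of `ℂ`-algebras of `ℂ`-valued functions.  A regular function on an
open set `U` is represented by any function `f : X → ℂ` extending it: `Reg U f` says that `f|_U` is
regular, and by `reg_congr` it depends on `f|_U` only. -/

structure FunSpace (X : Type) where
  top : TopologicalSpace X
  Reg : Set X → (X → ℂ) → Prop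
  reg_congr : ∀ {U : Set X} {f g : X → ℂ}, IsOpen[top] U → Set.EqOn f g U → Reg U f → Reg U g
  reg_mono : ∀ {U V : Set X} {f : X → ℂ}, IsOpen[top] U → IsOpen[top] V → V ⊆ U →
    Reg U f → Reg V f
  reg_glue : ∀ {U : Set X} {f : X → ℂ}, IsOpen[top] U →
    (∀ x ∈ U, ∃ V, IsOpen[top] V ∧ x ∈ V ∧ V ⊆ U ∧ Reg V f) → Reg U f
  reg_const : ∀ {U : Set X} (c : ℂ), IsOpen[top] U → Reg U (fun _ => c)
  reg_add : ∀ {U : Set X} {f g : X → ℂ}, IsOpen[top] U → Reg U f → Reg U g →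
    Reg U (fun x => f x + g x)
  reg_mul : ∀ {U : Set X} {f g : X → ℂ}, IsOpen[top] U → Reg U f → Reg U g →
    Reg U (fun x => f x * g x)

namespace FunSpace

/-- The Zariski topology on `ℂ^m`: the open sets are the complements of the common zero sets of
sets of polynomials. -/
@[reducible]
def zariski (m : ℕ) : TopologicalSpace (Fin m → ℂ) where
  IsOpen U := ∃ S : Set (MvPolynomial (Fin m) ℂ), U = {x | ∃ P ∈ S, eval x P ≠ 0}
  isOpen_univ := ⟨{1}, by ext x; simp⟩
  isOpen_inter := by
    rintro _ _ ⟨S, rfl⟩ ⟨T, rfl⟩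
    refine ⟨{R | ∃ P ∈ S, ∃ Q ∈ T, R = P * Q}, ?_⟩
    ext x
    constructor
    · rintro ⟨⟨P, hP, hPx⟩, Q, hQ, hQx⟩
      exact ⟨P * Q, ⟨P, hP, Q, hQ, rfl⟩, by rw [map_mul]; exact mul_ne_zero hPx hQx⟩
    · rintro ⟨_, ⟨P, hP, Q, hQ, rfl⟩, h⟩
      rw [map_mul] at h
      exact ⟨⟨P, hP, left_ne_zero_of_mul h⟩, Q, hQ, right_ne_zero_of_mul h⟩
  isOpen_sUnion := by
    intro 𝒰 h
    choose! S hS using h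
    refine ⟨{P | ∃ U ∈ 𝒰, P ∈ S U}, ?_⟩
    ext x
    constructor
    · rintro ⟨U, hU, hx⟩
      rw [hS U hU] at hx
      obtain ⟨P, hP, hPx⟩ := hx
      exact ⟨P, ⟨U, hU, hP⟩, hPx⟩
    · rintro ⟨P, ⟨U, hU, hP⟩, hPx⟩
      refine ⟨U, hU, ?_⟩
      rw [hS U hU]
      exact ⟨P, hP, hPx⟩

/-- Affine space `ℂ^m`: the regular functions are those that are locally quotients of
polynomials. -/
def affine (m : ℕ) : FunSpace (Fin m → ℂ) where
  top := zariski m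
  Reg U f := ∀ x ∈ U, ∃ V, IsOpen[zariski m] V ∧ x ∈ V ∧ V ⊆ U ∧
    ∃ P Q : MvPolynomial (Fin m) ℂ, ∀ y ∈ V, eval y Q ≠ 0 ∧ f y = eval y P / eval y Q
  reg_congr := by
    intro U f g _ hfg h x hx
    obtain ⟨V, hV, hxV, hVU, P, Q, hPQ⟩ := h x hx
    exact ⟨V, hV, hxV, hVU, P, Q, fun y hy =>
      ⟨(hPQ y hy).1, (hfg (hVU hy)).symm.trans (hPQ y hy).2⟩⟩
  reg_mono := by
    intro U W f _ hW hWU h x hx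
    obtain ⟨V, hV, hxV, hVU, P, Q, hPQ⟩ := h x (hWU hx)
    exact ⟨V ∩ W, @IsOpen.inter _ (zariski m) _ _ hV hW, ⟨hxV, hx⟩, Set.inter_subset_right, P, Q,
      fun y hy => hPQ y hy.1⟩
  reg_glue := by
    intro U f _ h x hx
    obtain ⟨V, _, hxV, hVU, h⟩ := h x hx
    obtain ⟨W, hW, hxW, hWV, h⟩ := h x hxV
    exact ⟨W, hW, hxW, hWV.trans hVU, h⟩
  reg_const := by
    intro U c hU x hx
    exact ⟨U, hU, hx, subset_rfl, C c, 1, fun y _ => by simp⟩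
  reg_add := by
    intro U f g _ hf hg x hx
    obtain ⟨V, hV, hxV, hVU, P, Q, hPQ⟩ := hf x hx
    obtain ⟨W, hW, hxW, hWU, R, S, hRS⟩ := hg x hx
    refine ⟨V ∩ W, @IsOpen.inter _ (zariski m) _ _ hV hW, ⟨hxV, hxW⟩,
      Set.inter_subset_left.trans hVU, P * S + Q * R, Q * S, fun y hy => ?_⟩
    obtain ⟨h1, h2⟩ := hPQ y hy.1
    obtain ⟨h3, h4⟩ := hRS y hy.2
    simp only [map_mul, map_add]
    exact ⟨mul_ne_zero h1 h3, by rw [h2, h4, div_add_div _ _ h1 h3]⟩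
  reg_mul := by
    intro U f g _ hf hg x hx
    obtain ⟨V, hV, hxV, hVU, P, Q, hPQ⟩ := hf x hx
    obtain ⟨W, hW, hxW, hWU, R, S, hRS⟩ := hg x hx
    refine ⟨V ∩ W, @IsOpen.inter _ (zariski m) _ _ hV hW, ⟨hxV, hxW⟩,
      Set.inter_subset_left.trans hVU, P * R, Q * S, fun y hy => ?_⟩
    obtain ⟨h1, h2⟩ := hPQ y hy.1
    obtain ⟨h3, h4⟩ := hRS y hy.2
    simp only [map_mul]
    exact ⟨mul_ne_zero h1 h3, by rw [h2, h4, div_mul_div_comm]⟩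

variable {X Y : Type}

/-- The induced structure on a subset: subspace topology, and the regular functions are those that
locally extend to regular functions of the ambient space. -/
def restrict (s : FunSpace X) (S : Set X) : FunSpace S where
  top := s.top.induced Subtype.val
  Reg V g := ∀ y ∈ V, ∃ (U : Set X) (f : X → ℂ), IsOpen[s.top] U ∧ (y : X) ∈ U ∧ s.Reg U f ∧
    ∀ z ∈ V, (z : X) ∈ U → g z = f z
  reg_congr := by
    intro V f g _ hfg h y hy
    obtain ⟨U, F, hU, hyU, hF, hz⟩ := h y hy
    exact ⟨U, F, hU, hyU, hF, fun z hzV hzU => (hfg hzV).symm.trans (hz z hzV hzU)⟩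
  reg_mono := by
    intro U V f _ _ hVU h y hy
    obtain ⟨W, F, hW, hyW, hF, hz⟩ := h y (hVU hy)
    exact ⟨W, F, hW, hyW, hF, fun z hzV hzU => hz z (hVU hzV) hzU⟩
  reg_glue := by
    intro V f _ h y hy
    obtain ⟨W, ⟨O, hO, rfl⟩, hyW, _, hreg⟩ := h y hy
    obtain ⟨U, F, hU, hyU, hF, hz⟩ := hreg y hyW
    have hUO : IsOpen[s.top] (U ∩ O) := @IsOpen.inter _ s.top _ _ hU hO
    exact ⟨U ∩ O, F, hUO, ⟨hyU, hyW⟩, s.reg_mono hU hUO Set.inter_subset_left hF,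
      fun z _ hzU => hz z hzU.2 hzU.1⟩
  reg_const := by
    intro V c _ y _
    exact ⟨Set.univ, fun _ => c, @isOpen_univ _ s.top, trivial,
      s.reg_const c (@isOpen_univ _ s.top), fun _ _ _ => rfl⟩
  reg_add := by
    intro V f g _ hf hg y hy
    obtain ⟨U, F, hU, hyU, hF, hz⟩ := hf y hy
    obtain ⟨U', F', hU', hyU', hF', hz'⟩ := hg y hy
    have hUU : IsOpen[s.top] (U ∩ U') := @IsOpen.inter _ s.top _ _ hU hU'
    exact ⟨U ∩ U', _, hUU, ⟨hyU, hyU'⟩, s.reg_add hUU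
      (s.reg_mono hU hUU Set.inter_subset_left hF) (s.reg_mono hU' hUU Set.inter_subset_right hF'),
      fun z hzV hzU => by simp only [hz z hzV hzU.1, hz' z hzV hzU.2]⟩
  reg_mul := by
    intro V f g _ hf hg y hy
    obtain ⟨U, F, hU, hyU, hF, hz⟩ := hf y hy
    obtain ⟨U', F', hU', hyU', hF', hz'⟩ := hg y hy
    have hUU : IsOpen[s.top] (U ∩ U') := @IsOpen.inter _ s.top _ _ hU hU'
    exact ⟨U ∩ U', _, hUU, ⟨hyU, hyU'⟩, s.reg_mul hUU
      (s.reg_mono hU hUU Set.inter_subset_left hF) (s.reg_mono hU' hUU Set.inter_subset_right hF'),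
      fun z hzV hzU => by simp only [hz z hzV hzU.1, hz' z hzV hzU.2]⟩

/-- The quotient by an equivalence relation: quotient topology, and a function is regular when its
pullback is. For the orbit relation of a group these are the invariant regular functions. -/
def quot (s : FunSpace X) (r : Setoid X) : FunSpace (Quotient r) where
  top := s.top.coinduced (Quotient.mk r)
  Reg U f := s.Reg (Quotient.mk r ⁻¹' U) (fun x => f (Quotient.mk r x))
  reg_congr := fun hU hfg h => s.reg_congr hU (fun _ hx => hfg hx) h
  reg_mono := fun hU hV hVU h => s.reg_mono hU hV (Set.preimage_mono hVU) h
  reg_glue := by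
    intro U f hU h
    refine s.reg_glue hU fun x hx => ?_
    obtain ⟨V, hV, hxV, hVU, hf⟩ := h _ hx
    exact ⟨_, hV, hxV, Set.preimage_mono hVU, hf⟩
  reg_const := fun c hU => s.reg_const c hU
  reg_add := fun hU hf hg => s.reg_add hU hf hg
  reg_mul := fun hU hf hg => s.reg_mul hU hf hg

/-- Isomorphism: a homeomorphism under which the regular functions correspond. -/
def Iso (s : FunSpace X) (t : FunSpace Y) : Prop :=
  ∃ e : X ≃ Y, (∀ V : Set Y, IsOpen[t.top] V ↔ IsOpen[s.top] (e ⁻¹' V)) ∧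
    ∀ V : Set Y, IsOpen[t.top] V → ∀ f : Y → ℂ, t.Reg V f ↔ s.Reg (e ⁻¹' V) (fun x => f (e x))

/-- Birational equivalence: some dense open subset of the one space is isomorphic to a dense open
subset of the other. -/
def Birational (s : FunSpace X) (t : FunSpace Y) : Prop :=
  ∃ (U : Set X) (V : Set Y), IsOpen[s.top] U ∧ @Dense X s.top U ∧ IsOpen[t.top] V ∧
    @Dense Y t.top V ∧ Iso (s.restrict U) (t.restrict V)

end FunSpace

namespace BHK

/-- The group `(ℂ^*)^{n+1}`. -/
abbrev Torus (n : ℕ) : Type := Fin (n + 1) → ℂˣ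

/-- The set `ℂ^{n+1} ∖ {0}`. -/
abbrev Punctured (n : ℕ) : Type := ↥({0}ᶜ : Set (Fin (n + 1) → ℂ))

/-- Square matrices of exponents, with rows and columns indexed by `0, …, n`. -/
abbrev Mat (n : ℕ) (R : Type) : Type := Matrix (Fin (n + 1)) (Fin (n + 1)) R

variable {n : ℕ}

/-- The coordinatewise scaling action of `(ℂ^*)^{n+1}` on `ℂ^{n+1} ∖ {0}`. -/
instance puncturedAction : MulAction (Torus n) (Punctured n) where
  smul t x := ⟨fun j => (t j : ℂ) * x.1 j, fun h => x.2 <| by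
    funext j
    have := congrFun (Set.mem_singleton_iff.1 h) j
    simpa using this⟩
  one_smul x := Subtype.ext <| funext fun j => by
    change ((1 : ℂˣ) : ℂ) * x.1 j = x.1 j
    simp
  mul_smul s t x := Subtype.ext <| funext fun j => by
    change ((s j * t j : ℂˣ) : ℂ) * x.1 j = (s j : ℂ) * ((t j : ℂ) * x.1 j)
    rw [Units.val_mul, mul_assoc]

/-- The subgroup `ℂ^* = {(μ^{w_0}, …, μ^{w_n})}` of `(ℂ^*)^{n+1}` given by weights `w`. -/
def scaling (w : Fin (n + 1) → ℤ) : Subgroup (Torus n) where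
  carrier := {t | ∃ μ : ℂˣ, ∀ j, t j = μ ^ w j}
  one_mem' := ⟨1, fun j => by simp⟩
  mul_mem' := by
    rintro s t ⟨μ, hμ⟩ ⟨ν, hν⟩
    exact ⟨μ * ν, fun j => by rw [Pi.mul_apply, hμ, hν, mul_zpow]⟩
  inv_mem' := by
    rintro s ⟨μ, hμ⟩
    exact ⟨μ⁻¹, fun j => by rw [Pi.inv_apply, hμ, inv_zpow]⟩

/-- The points of the weighted projective space `Wℙ^n(w_0, …, w_n)`, the quotient of
`ℂ^{n+1} ∖ {0}` by `ℂ^*`. -/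
abbrev WPoint (w : Fin (n + 1) → ℤ) : Type :=
  Quotient (MulAction.orbitRel (scaling w) (Punctured n))

/-- The weighted projective space `Wℙ^n(w_0, …, w_n)` as a variety. -/
def weightedProjectiveSpace (w : Fin (n + 1) → ℤ) : FunSpace (WPoint w) :=
  ((FunSpace.affine (n + 1)).restrict {0}ᶜ).quot _

/-- `(ℂ^*)^{n+1}` acts on the weighted projective space. -/
instance weightedAction (w : Fin (n + 1) → ℤ) : MulAction (Torus n) (WPoint w) where
  smul t := Quotient.map (fun x => t • x) <| by
    rintro _ y ⟨c, rfl⟩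
    refine ⟨c, ?_⟩
    change (c : Torus n) • t • y = t • (c : Torus n) • y
    rw [smul_smul, smul_smul, mul_comm]
  one_smul := by
    rintro ⟨x⟩
    exact congrArg (Quotient.mk _) (one_smul _ x)
  mul_smul := by
    rintro s t ⟨x⟩
    exact congrArg (Quotient.mk _) (mul_smul s t x)

theorem scaling_smul (w : Fin (n + 1) → ℤ) {t : Torus n} (ht : t ∈ scaling w) (p : WPoint w) :
    t • p = p := by
  obtain ⟨x⟩ := p
  exact Quotient.sound ⟨⟨t, ht⟩, rfl⟩

/-- The polynomial `F_A = ∑_i ∏_j x_j^{a_ij}`. -/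
def poly (A : Mat n ℕ) : MvPolynomial (Fin (n + 1)) ℂ :=
  ∑ i, ∏ j, X j ^ A i j

/-- The standing conditions on `A`: it is invertible, `F_A` is quasihomogeneous with positive
weights, and the origin is the unique singular point of the zero set of `F_A` in `ℂ^{n+1}`. -/
structure IsInvertiblePotential (A : Mat n ℕ) : Prop where
  invertible : (A.map (Nat.cast : ℕ → ℚ)).det ≠ 0
  quasihomogeneous : ∃ (q : Fin (n + 1) → ℕ) (d : ℕ), (∀ j, 0 < q j) ∧ 0 < d ∧
    ∀ i, ∑ j, A i j * q j = d
  nondegenerate : ∀ x : Fin (n + 1) → ℂ,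
    (eval x (poly A) = 0 ∧ ∀ j, eval x (pderiv j (poly A)) = 0) ↔ x = 0

/-- The hypersurface `X_A = {F_A = 0}` in `Wℙ^n(w)`, as a set of points. -/
def zeroSet (A : Mat n ℕ) (w : Fin (n + 1) → ℤ) : Set (WPoint w) :=
  {p | ∃ x : Punctured n, Quotient.mk _ x = p ∧ eval x.1 (poly A) = 0}

/-- The hypersurface `X_A` in `Wℙ^n(w)` as a variety. -/
def hypersurface (A : Mat n ℕ) (w : Fin (n + 1) → ℤ) : FunSpace (zeroSet A w) :=
  (weightedProjectiveSpace w).restrict (zeroSet A w)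

/-- The group `Aut(F_A)` of diagonal automorphisms. -/
def Aut (A : Mat n ℕ) : Subgroup (Torus n) where
  carrier := {t | ∀ x : Fin (n + 1) → ℂ,
    eval (fun j => (t j : ℂ) * x j) (poly A) = eval x (poly A)}
  one_mem' := fun x => by simp
  mul_mem' := by
    intro s t hs ht x
    rw [← ht x, ← hs (fun j => (t j : ℂ) * x j)]
    simp [mul_assoc]
  inv_mem' := by
    intro t ht x
    have h := ht (fun j => ((t⁻¹) j : ℂ) * x j)
    simpa using h.symm

/-- `SL(F_A)`: the diagonal automorphisms with `∏_j λ_j = 1`. -/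
def SL (A : Mat n ℕ) : Subgroup (Torus n) where
  carrier := {t | t ∈ Aut A ∧ ∏ j, t j = 1}
  one_mem' := ⟨one_mem _, by simp⟩
  mul_mem' := by
    rintro s t ⟨hs, hs1⟩ ⟨ht, ht1⟩
    exact ⟨mul_mem hs ht, by simp [Finset.prod_mul_distrib, hs1, ht1]⟩
  inv_mem' := by
    rintro t ⟨ht, ht1⟩
    exact ⟨inv_mem ht, by simp [ht1]⟩

/-- `J_{F_A} = Aut(F_A) ∩ ℂ^*`. -/
def J (A : Mat n ℕ) (w : Fin (n + 1) → ℤ) : Subgroup (Torus n) :=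
  Aut A ⊓ scaling w

/-- The action on `Wℙ^n(w)` of the quotient group `K / J_{F_A}`, where `J_{F_A} ⊆ K`. -/
def quotientAction (A : Mat n ℕ) (w : Fin (n + 1) → ℤ) (K : Subgroup (Torus n)) :
    (K ⧸ (J A w).subgroupOf K) →* Equiv.Perm (WPoint w) :=
  QuotientGroup.lift _ ((MulAction.toPermHom (Torus n) (WPoint w)).comp K.subtype) <| by
    intro k hk
    ext p
    exact scaling_smul w (Subgroup.mem_subgroupOf.1 hk).2 p

/-- Two points of `X_A` are identified when they lie in the same orbit of `K / J_{F_A}`. -/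
def orbitSetoid (A : Mat n ℕ) (w : Fin (n + 1) → ℤ) (K : Subgroup (Torus n)) :
    Setoid (zeroSet A w) where
  r p p' := ∃ γ : K ⧸ (J A w).subgroupOf K, quotientAction A w K γ p.1 = p'.1
  iseqv :=
    { refl := fun p => ⟨1, by simp⟩
      symm := by
        rintro p p' ⟨γ, h⟩
        exact ⟨γ⁻¹, by rw [map_inv, Equiv.Perm.inv_eq_iff_eq, h]⟩
      trans := by
        rintro p p' p'' ⟨γ, h⟩ ⟨γ', h'⟩
        exact ⟨γ' * γ, by rw [map_mul, Equiv.Perm.mul_apply, h, h']⟩ }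

/-- The quotient variety `X_A / (K / J_{F_A})`, where `X_A ⊆ Wℙ^n(w)` and
`J_{F_A} ⊆ K ⊆ Aut(F_A)`. For `K = G` this is `Z_{A,G}`. -/
def orbifold (A : Mat n ℕ) (w : Fin (n + 1) → ℤ) (K : Subgroup (Torus n)) :
    FunSpace (Quotient (orbitSetoid A w K)) :=
  (hypersurface A w).quot _

/-- The row sums `q = B e` of a matrix `B`. -/
def rowSum (B : Mat n ℤ) : Fin (n + 1) → ℤ := fun i => ∑ j, B i j

/-- `pr`, the map `h ↦ (e^{2πi h_j / d})_j` from `ℤ^{n+1}` to `(ℂ^*)^{n+1}`. -/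
def pr (d : ℕ) (h : Fin (n + 1) → ℤ) : Torus n := fun j =>
  Units.mk0 (Complex.exp (2 * Real.pi * Complex.I * (h j : ℂ) / (d : ℂ))) (Complex.exp_ne_zero _)

theorem pr_zero (d : ℕ) : pr d (0 : Fin (n + 1) → ℤ) = 1 := by
  funext j
  ext
  simp [pr]

theorem pr_add (d : ℕ) (h k : Fin (n + 1) → ℤ) : pr d (h + k) = pr d h * pr d k := by
  funext j
  ext
  simp only [pr, Pi.add_apply, Pi.mul_apply, Units.val_mk0, Units.val_mul, Int.cast_add]
  rw [← Complex.exp_add]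
  congr 1
  ring

theorem pr_neg (d : ℕ) (h : Fin (n + 1) → ℤ) : pr d (-h) = (pr d h)⁻¹ := by
  rw [eq_inv_iff_mul_eq_one, ← pr_add, neg_add_cancel, pr_zero]

/-- The dual group `G^T`: the products `∏_i (ρ_i^T)^{s_i}`, with `ρ_i^T = (e^{2πi b_ij / d})_j`, over
those `s ∈ ℤ^{n+1}` for which the monomial `∏_i x_i^{s_i}` is `G`-invariant. As exponents may be
negative, the monomial is considered as a function on `(ℂ^*)^{n+1}`. -/
def dualGroup (B : Mat n ℤ) (d : ℕ) (G : Subgroup (Torus n)) : Subgroup (Torus n) where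
  carrier := {t | ∃ s : Fin (n + 1) → ℤ,
    (∀ g ∈ G, ∀ x : Torus n, ∏ i, (g i * x i) ^ s i = ∏ i, x i ^ s i) ∧
      t = ∏ i, pr d (B i) ^ s i}
  one_mem' := ⟨0, by simp, by simp⟩
  mul_mem' := by
    rintro _ _ ⟨s, hs, rfl⟩ ⟨s', hs', rfl⟩
    refine ⟨s + s', fun g hg x => ?_, ?_⟩
    · simp only [Pi.add_apply, zpow_add, Finset.prod_mul_distrib, hs g hg x, hs' g hg x]
    · simp only [Pi.add_apply, zpow_add, Finset.prod_mul_distrib]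
  inv_mem' := by
    rintro _ ⟨s, hs, rfl⟩
    refine ⟨-s, fun g hg x => ?_, ?_⟩
    · simp only [Pi.neg_apply, zpow_neg, Finset.prod_inv_distrib, hs g hg x]
    · simp only [Pi.neg_apply, zpow_neg, Finset.prod_inv_distrib]

/-- The exponent matrix `d I` of the Fermat polynomial `∑ y_i^d`. -/
def fermat (n d : ℕ) : Mat n ℕ := d • (1 : Mat n ℕ)

/-- The Shioda map `φ_M` on `(ℂ^*)^{n+1}`, `x_j = ∏_k y_k^{m_jk}`. Since `φ_M(g y) = φ_M(g) φ_M(y)`,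
it is also the pushforward `(φ_M)_*` of diagonal automorphisms. -/
def shioda (M : Mat n ℤ) : Torus n →* Torus n where
  toFun y := fun j => ∏ k, y k ^ M j k
  map_one' := by
    funext j
    simp
  map_mul' y z := by
    funext j
    simp [mul_zpow, Finset.prod_mul_distrib]

/-- `(φ_M)_*^{-1}(G)`, for the homomorphism `(φ_M)_*` defined on `Aut(F_{dI})`. -/
def shiodaPreimage (M : Mat n ℤ) (d : ℕ) (G : Subgroup (Torus n)) : Subgroup (Torus n) :=
  Aut (fermat n d) ⊓ G.comap (shioda M)

/-- `H^{⊥_M}` for a subgroup `H` of `Aut(F_{dI})`: the image under `pr` of the set of `s ∈ ℤ^{n+1}`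
with `s^T M h ∈ dℤ` for all `h ∈ pr^{-1}(H)`. -/
def perp (M : Mat n ℤ) (d : ℕ) (H : Subgroup (Torus n)) : Subgroup (Torus n) where
  carrier := pr d '' {s | ∀ h : Fin (n + 1) → ℤ, pr d h ∈ H → (d : ℤ) ∣ s ⬝ᵥ M.mulVec h}
  one_mem' := ⟨0, fun h _ => by simp, pr_zero d⟩
  mul_mem' := by
    rintro _ _ ⟨s, hs, rfl⟩ ⟨t, ht, rfl⟩
    exact ⟨s + t, fun h hh => by rw [add_dotProduct]; exact dvd_add (hs h hh) (ht h hh),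
      pr_add d s t⟩
  inv_mem' := by
    rintro _ ⟨s, hs, rfl⟩
    exact ⟨-s, fun h hh => by rw [neg_dotProduct]; exact (dvd_neg).2 (hs h hh), pr_neg d s⟩

end BHK

end

noncomputable section

open MvPolynomial
open scoped Topology

namespace BHK
variable {n : ℕ}

/-! ### Characters and isotypic components -/

/-! Let `N = d * e` and `M = e • B`, so that `A * M = M * A = N • 1`. The Shioda map `φ_M` is a
surjective endomorphism of the torus with finite kernel, and the identity `A * M = N • 1` says that
it pulls `F_A` back to the Fermat polynomial of degree `N`. Over the torus, the cone of `X_A` is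
therefore the quotient of the Fermat cone by `ker φ_M`. Scalars map onto the scaling group of
weights `q`, and an element with image in `G ⊆ Aut(F_A)` has `N`-th power `1`. So dividing by `G`
and scaling downstairs amounts to dividing by `H` and scalars upstairs. This is `birational_shioda`.

Two points need work. The torus parts must be dense, which holds once no variable divides the
polynomial: every column of `A`, and for `A^T` every row of `A`, must contain a zero. Nondegeneracy
and `n ≥ 2` give both (`exists_zero_in_column`, `exists_zero_in_row`), and the Nullstellensatz turns
this into density (`exists_torus_point`).

The quotients must also agree as spaces with functions. Open sets and regular functions are
described by polynomials on the cones and descended by isotypic components: a polynomial splits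
according to the characters of the group divided out, and linear independence of characters lets
relations valid along an orbit pass to each component. This treats the infinite scaling group and
the finite kernel of `φ_M` alike.

The dual statement is the same result for `A^T`, `B^T` and `G^T`, once `perp_shiodaPreimage`
identifies `H^⊥` with the preimage of `G^T` under `φ_{eB^T}`. -/

theorem sum_filter_eq_zero_of_character_sum {Γ ι : Type*} [MulOneClass Γ] (s : Finset ι)
    (c : ι → ℂ) (ψ : ι → Γ →* ℂ) (h : ∀ g, ∑ i ∈ s, c i * ψ i g = 0) (χ : Γ →* ℂ)
    [DecidablePred fun i => ψ i = χ] :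
    ∑ i ∈ s with ψ i = χ, c i = 0 := by
  classical
  -- Different indices may carry the same character, so coefficients are grouped by character before
  -- Dedekind's independence theorem applies.
  have hli := linearIndependent_iff'.1 (linearIndependent_monoidHom Γ ℂ)
    (s.image ψ) (fun θ => ∑ i ∈ s with ψ i = θ, c i) (by
      funext g
      simp only [Finset.sum_apply, Pi.smul_apply, smul_eq_mul, Pi.zero_apply]
      rw [← h g, ← Finset.sum_fiberwise_of_maps_to (t := s.image ψ) (g := ψ)
        (fun i hi => Finset.mem_image_of_mem _ hi)]
      refine Finset.sum_congr rfl fun θ _ => ?_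
      rw [Finset.sum_mul]
      refine Finset.sum_congr rfl fun i hi => ?_
      rw [(Finset.mem_filter.1 hi).2])
  by_cases hχ : χ ∈ s.image ψ
  · convert hli χ hχ
  · rw [Finset.filter_false_of_mem, Finset.sum_empty]
    rintro i hi rfl
    exact hχ (Finset.mem_image_of_mem _ hi)

/-- The `j`-th coordinate character of a subgroup of `(ℂ^*)^{n+1}`, written additively. -/
def coordChar (Γ : Subgroup (Torus n)) (j : Fin (n + 1)) : Additive (Γ →* ℂ) :=
  Additive.ofMul ((Units.coeHom ℂ).comp ((Pi.evalMonoidHom _ j).comp Γ.subtype))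

theorem toMul_weight_coordChar (Γ : Subgroup (Torus n)) (m : Fin (n + 1) →₀ ℕ) (g : Γ) :
    (Finsupp.weight (coordChar Γ) m).toMul g = ∏ j, ((g : Torus n) j : ℂ) ^ m j := by
  rw [Finsupp.weight_apply, Finsupp.sum_fintype _ _ (by simp), toMul_sum, MonoidHom.finsetProd_apply]
  rfl

/-- The part of a polynomial on which `Γ` acts through the character `χ`. -/
abbrev component (Γ : Subgroup (Torus n)) (χ : Additive (Γ →* ℂ)) :
    MvPolynomial (Fin (n + 1)) ℂ →ₗ[ℂ] MvPolynomial (Fin (n + 1)) ℂ :=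
  weightedHomogeneousComponent (coordChar Γ) χ

/-- Expanding along the orbit gives `R(g y) = ∑ χ(g) R_χ(y)`, a linear relation between distinct
characters of `Γ`. No averaging is involved, so `Γ` may be infinite. -/
theorem eval_component_eq_zero (Γ : Subgroup (Torus n)) {R : MvPolynomial (Fin (n + 1)) ℂ}
    {y : Fin (n + 1) → ℂ} (h : ∀ g ∈ Γ, eval (fun j => (g j : ℂ) * y j) R = 0)
    (χ : Additive (Γ →* ℂ)) : eval y (component Γ χ R) = 0 := by
  classical
  have := sum_filter_eq_zero_of_character_sum R.support (fun m => coeff m R * ∏ j, y j ^ m j)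
    (fun m => (Finsupp.weight (coordChar Γ) m).toMul) (fun g => by
      rw [← h g g.2, eval_eq']
      refine Finset.sum_congr rfl fun m _ => ?_
      simp only [toMul_weight_coordChar, mul_pow, Finset.prod_mul_distrib]
      ring) χ.toMul
  rw [weightedHomogeneousComponent_apply, map_sum, ← this]
  refine Finset.sum_congr (Finset.filter_congr fun m _ => Additive.toMul.injective.eq_iff.symm)
    fun m _ => ?_
  rw [eval_monomial, Finsupp.prod_fintype _ _ (by simp)]

/-- Used with `a` the value of a `Γ`-invariant function: an equation `f Q = P` along an orbit
survives in each isotypic component, with the same `χ` on both sides. It follows from the vanishing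
lemma applied to `a Q - P`. -/
theorem mul_eval_component_eq (Γ : Subgroup (Torus n)) {P Q : MvPolynomial (Fin (n + 1)) ℂ}
    {y : Fin (n + 1) → ℂ} {a : ℂ}
    (h : ∀ g ∈ Γ, a * eval (fun j => (g j : ℂ) * y j) Q = eval (fun j => (g j : ℂ) * y j) P)
    (χ : Additive (Γ →* ℂ)) :
    a * eval y (component Γ χ Q) = eval y (component Γ χ P) := by
  have := eval_component_eq_zero Γ (R := a • Q - P) (y := y)
    (fun g hg => by rw [map_sub, smul_eval, h g hg, sub_self]) χ
  rw [map_sub, map_smul, map_sub, smul_eval] at this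
  exact sub_eq_zero.1 this

theorem exists_eval_component_ne_zero (Γ : Subgroup (Torus n))
    {R : MvPolynomial (Fin (n + 1)) ℂ} {y : Fin (n + 1) → ℂ} (h : eval y R ≠ 0) :
    ∃ χ, eval y (component Γ χ R) ≠ 0 := by
  by_contra! h0
  refine h ?_
  have hf := weightedHomogeneousComponent_finsupp (w := coordChar Γ) R
  rw [← sum_weightedHomogeneousComponent (coordChar Γ) R, finsum_eq_sum _ hf, map_sum]
  exact Finset.sum_eq_zero fun χ _ => h0 χ

theorem eval_smul_component (Γ : Subgroup (Torus n)) (R : MvPolynomial (Fin (n + 1)) ℂ)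
    (χ : Additive (Γ →* ℂ)) (g : Γ) (y : Fin (n + 1) → ℂ) :
    eval (fun j => ((g : Torus n) j : ℂ) * y j) (component Γ χ R) =
      χ.toMul g * eval y (component Γ χ R) := by
  rw [eval_eq', eval_eq', Finset.mul_sum]
  refine Finset.sum_congr rfl fun m hm => ?_
  have hw := weightedHomogeneousComponent_isWeightedHomogeneous (w := coordChar Γ) χ R
    (mem_support_iff.1 hm)
  rw [← hw, toMul_weight_coordChar]
  simp only [mul_pow, Finset.prod_mul_distrib]
  ring

/-! ### The monomials of `F_A` -/

theorem eval_poly (A : Mat n ℕ) (x : Fin (n + 1) → ℂ) :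
    eval x (poly A) = ∑ i, ∏ j, x j ^ A i j := by
  simp [poly]

theorem eval_pderiv_poly (A : Mat n ℕ) (k : Fin (n + 1)) (x : Fin (n + 1) → ℂ) :
    eval x (pderiv k (poly A)) =
      ∑ i, (A i k : ℂ) * ∏ j, x j ^ (A i j - if j = k then 1 else 0) := by
  have hmon : ∀ i, ∏ j, (X j : MvPolynomial (Fin (n + 1)) ℂ) ^ A i j =
      monomial (Finsupp.equivFunOnFinite.symm (A i)) 1 := fun i => by
    rw [monomial_eq, Finsupp.prod_fintype _ _ (by simp)]
    simp
  rw [poly, map_sum, map_sum]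
  refine Finset.sum_congr rfl fun i _ => ?_
  rw [hmon, pderiv_monomial, eval_monomial, Finsupp.prod_fintype _ _ (by simp)]
  simp [Finsupp.single_apply, eq_comm]

theorem rows_injective {A : Mat n ℕ} (hA : (A.map (Nat.cast : ℕ → ℚ)).det ≠ 0) :
    Function.Injective A := by
  intro i i' h
  by_contra hne
  exact hA (Matrix.det_zero_of_row_eq hne (by funext j; simp [h]))

theorem prod_smul_pow_eq {A : Mat n ℕ} {t : Torus n} {i : Fin (n + 1)} (h : ∏ j, t j ^ A i j = 1)
    (x : Fin (n + 1) → ℂ) : ∏ j, ((t j : ℂ) * x j) ^ A i j = ∏ j, x j ^ A i j := by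
  have h' : ∏ j, (t j : ℂ) ^ A i j = 1 := by
    simpa using congrArg Units.val h
  simp only [mul_pow, Finset.prod_mul_distrib, h', one_mul]

theorem mem_Aut_of_prod {A : Mat n ℕ} {t : Torus n} (h : ∀ i, ∏ j, t j ^ A i j = 1) :
    t ∈ Aut A := fun x => by
  rw [eval_poly, eval_poly]
  exact Finset.sum_congr rfl fun i _ => prod_smul_pow_eq (h i) x

/-- The monomial `∏_j x_j^{m_j}` as a character of `(ℂ^*)^{n+1}`. -/
def monomialChar (m : Fin (n + 1) → ℕ) : Torus n →* ℂ where
  toFun t := ∏ j, (t j : ℂ) ^ m j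
  map_one' := by simp
  map_mul' s t := by simp [mul_pow, Finset.prod_mul_distrib]

theorem monomialChar_apply (m : Fin (n + 1) → ℕ) (t : Torus n) :
    monomialChar m t = ∏ j, (t j : ℂ) ^ m j := rfl

theorem monomialChar_injective : Function.Injective (monomialChar (n := n)) := by
  intro a b h
  funext j
  -- The point with `j`-th coordinate `2` and all others `1` reads off the exponent of `x_j`.
  have := DFunLike.congr_fun h (Function.update (1 : Torus n) j (Units.mk0 2 two_ne_zero))
  have key : ∀ m : Fin (n + 1) → ℕ,
      monomialChar m (Function.update (1 : Torus n) j (Units.mk0 2 two_ne_zero)) = 2 ^ m j :=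
      fun m => by
    rw [monomialChar_apply, Finset.prod_eq_single j]
    · simp
    · intro k _ hk
      simp [Function.update_of_ne hk]
    · simp
  rw [key, key] at this
  have h2 : (2 : ℕ) ^ a j = 2 ^ b j := by exact_mod_cast this
  exact Nat.pow_right_injective le_rfl h2

/-- The difference `F_A(t g) - F_A(g)` is `∑ (t^{A_i} - 1) g^{A_i}`. Distinct rows give distinct
characters of the torus, so every coefficient must vanish. -/
theorem mem_Aut_iff {A : Mat n ℕ} (hA : Function.Injective A) {t : Torus n} :
    t ∈ Aut A ↔ ∀ i, ∏ j, t j ^ A i j = 1 := by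
  classical
  refine ⟨fun ht i => ?_, mem_Aut_of_prod⟩
  have := sum_filter_eq_zero_of_character_sum Finset.univ
    (fun i => (∏ j, (t j : ℂ) ^ A i j) - 1) (fun i => monomialChar (A i)) (fun g => by
      have := ht fun j => g j
      rw [eval_poly, eval_poly, ← sub_eq_zero, ← Finset.sum_sub_distrib] at this
      rw [← this]
      refine Finset.sum_congr rfl fun k _ => ?_
      change _ * ∏ j, (g j : ℂ) ^ A k j = _
      simp only [mul_pow, Finset.prod_mul_distrib]
      ring) (monomialChar (A i))
  have hf : (Finset.univ.filter fun k => monomialChar (A k) = monomialChar (A i)) = {i} := by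
    ext k
    rw [Finset.mem_filter_univ, Finset.mem_singleton]
    exact (monomialChar_injective.comp hA).eq_iff (a := k) (b := i)
  rw [hf, Finset.sum_singleton, sub_eq_zero] at this
  ext
  push_cast
  exact this

end BHK

namespace BHK
variable {n : ℕ}

/-! ### Zeros in the exponent matrix -/

theorem exists_ne_ne (hn : 2 ≤ n) (j k : Fin (n + 1)) : ∃ l, l ≠ j ∧ l ≠ k := by
  obtain ⟨l, -, hl⟩ := Finset.exists_mem_notMem_of_card_lt_card
    (s := {j, k}) (t := (Finset.univ : Finset (Fin (n + 1))))
    (lt_of_le_of_lt Finset.card_le_two (by simp; omega))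
  simp only [Finset.mem_insert, Finset.mem_singleton, not_or] at hl
  exact ⟨l, hl⟩

/-- Nondegeneracy at the `j`-th coordinate axis: some monomial of `F_A` is `x_j^a` or `x_j^a x_k`. -/
theorem IsInvertiblePotential.exists_row {A : Mat n ℕ} (hA : IsInvertiblePotential A)
    (j : Fin (n + 1)) :
    ∃ i, (∀ l ≠ j, A i l ≤ 1) ∧ ∃ k, ∀ l, l ≠ j → l ≠ k → A i l = 0 := by
  -- Without such a row, `F_A` and all its partial derivatives vanish at the `j`-th unit vector:
  -- only `x_j^a` survives in `F_A` there, and only `x_j^a` or `x_j^a x_k` in the `k`-th derivative.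
  by_contra! hcon
  have hpow : ∀ m : Fin (n + 1) → ℕ,
      ∏ l, (Pi.single j 1 : Fin (n + 1) → ℂ) l ^ m l ≠ 0 → ∀ l ≠ j, m l = 0 := by
    intro m hm l hl
    by_contra h0
    exact hm (Finset.prod_eq_zero (Finset.mem_univ l) (by rw [Pi.single_eq_of_ne hl, zero_pow h0]))
  have hne : (Pi.single j 1 : Fin (n + 1) → ℂ) ≠ 0 := by simp
  refine hne ((hA.nondegenerate _).1 ⟨?_, fun k => ?_⟩)
  · rw [eval_poly]
    refine Finset.sum_eq_zero fun i _ => ?_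
    by_contra h
    have h := hpow _ h
    obtain ⟨l, hl, -, h0⟩ := hcon i (fun l hl => by rw [h l hl]; exact zero_le_one) j
    exact h0 (h l hl)
  · rw [eval_pderiv_poly]
    refine Finset.sum_eq_zero fun i _ => ?_
    by_contra h
    have h := hpow _ (right_ne_zero_of_mul h)
    obtain ⟨l, hl, hlk, h0⟩ := hcon i (fun l hl => by
      have := h l hl
      split_ifs at this <;> omega) k
    have := h l hl
    rw [if_neg hlk] at this
    omega

/-- Both monomials have the same weighted degree and the weights are positive, so divisibility
forces equality of exponents; distinct rows of an invertible matrix differ. -/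
theorem IsInvertiblePotential.row_eq_of_le {A : Mat n ℕ} (hA : IsInvertiblePotential A)
    {i i' : Fin (n + 1)} (h : ∀ l, A i l ≤ A i' l) : i = i' := by
  obtain ⟨q, δ, hq, -, hδ⟩ := hA.quasihomogeneous
  refine rows_injective hA.invertible (funext fun l => ?_)
  have := (Finset.sum_eq_sum_iff_of_le fun l _ => Nat.mul_le_mul_right (q l) (h l)).1
    ((hδ i).trans (hδ i').symm) l (Finset.mem_univ l)
  exact Nat.eq_of_mul_eq_mul_right (hq l) this

/-- A row without zeros involves at least three variables, so it is none of the rows `ρ j` attached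
to the axes. By pigeonhole two axes then share a row, which has to be small enough to divide the
full one. -/
theorem IsInvertiblePotential.exists_zero_in_row {A : Mat n ℕ} (hA : IsInvertiblePotential A)
    (hn : 2 ≤ n) (i : Fin (n + 1)) : ∃ j, A i j = 0 := by
  by_contra! hfull
  choose ρ hρ1 κ hρ2 using hA.exists_row
  have hnot : ∀ j, ρ j ≠ i := by
    rintro j rfl
    obtain ⟨l, hl, hl'⟩ := exists_ne_ne hn j (κ j)
    exact hfull l (hρ2 j l hl hl')
  have hinj : ¬ Function.Injective ρ := fun h =>
    let ⟨j, hj⟩ := Finite.injective_iff_surjective.1 h i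
    hnot j hj
  rw [Function.Injective] at hinj
  push Not at hinj
  obtain ⟨j, j', hjj, hne⟩ := hinj
  -- A row serving two different axes has all exponents at most `1`, so it lies below the full row.
  refine hnot j (hA.row_eq_of_le fun l => ?_)
  have h1 : A (ρ j) l ≤ 1 := by
    by_cases hl : l = j
    · rw [hjj]
      exact hρ1 j' l (hl ▸ hne)
    · exact hρ1 j l hl
  have := hfull l
  omega

/-- If the column is full, then `F_A = x_j g`, which is singular wherever `x_j = g = 0`. A nonzero
such point is found in the plane of two further coordinates `k`, `l`, with `x_k = 1` and `x_l` a
root of a one-variable polynomial. -/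
theorem IsInvertiblePotential.exists_zero_in_column {A : Mat n ℕ} (hA : IsInvertiblePotential A)
    (hn : 2 ≤ n) (j : Fin (n + 1)) : ∃ i, A i j = 0 := by
  classical
  by_contra! hfull
  obtain ⟨k, hkj, -⟩ := exists_ne_ne hn j j
  obtain ⟨l, hlj, hlk⟩ := exists_ne_ne hn j k
  obtain ⟨i, hi1, κ, hi2⟩ := hA.exists_row l
  have hij : A i j = 1 := by
    have := hi1 j hlj.symm
    have := hfull i
    omega
  obtain rfl : κ = j := by
    by_contra h
    exact hfull i (hi2 j hlj.symm (Ne.symm h))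
  -- Otherwise row `i` is the single variable of the full column, which divides every monomial.
  have hil : A i l ≠ 0 := by
    intro h0
    obtain ⟨i', hi', -⟩ := exists_ne_ne hn i i
    refine hi' (hA.row_eq_of_le fun m => ?_).symm
    by_cases hm : m = κ
    · rw [hm, hij]
      exact Nat.one_le_iff_ne_zero.2 (hfull i')
    · by_cases hml : m = l
      · simp [hml, h0]
      · simp [hi2 m hml hm]
  -- These are the monomials that survive in the derivative along the full column at a point
  -- supported on `k` and `l`. At `x_k = 1`, `x_l = t` that derivative is `p(t)`.
  let I : Finset (Fin (n + 1)) :=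
    {i | A i κ = 1 ∧ ∀ m, m ≠ κ → m ≠ k → m ≠ l → A i m = 0}
  have hiI : i ∈ I := by
    simp only [I, Finset.mem_filter, Finset.mem_univ, true_and]
    exact ⟨hij, fun m h1 _ h2 => hi2 m h2 h1⟩
  let p : Polynomial ℂ := ∑ i ∈ I, Polynomial.X ^ A i l
  -- Coefficients of `p` count monomials, so nothing cancels, and `p` has positive degree.
  have hcoeff : p.coeff (A i l) ≠ 0 := by
    simp only [p, Polynomial.finsetSum_coeff, Polynomial.coeff_X_pow]
    rw [Finset.sum_boole, Nat.cast_ne_zero]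
    exact Finset.card_ne_zero_of_mem (Finset.mem_filter.2 ⟨hiI, rfl⟩)
  obtain ⟨t, ht⟩ := IsAlgClosed.exists_root p (fun h => by
    have := Polynomial.le_degree_of_ne_zero hcoeff
    rw [h] at this
    exact hil (by exact_mod_cast Nat.le_zero.1 (by exact_mod_cast this)))
  have hsum : ∑ i ∈ I, t ^ A i l = 0 := by
    rw [Polynomial.IsRoot.def] at ht
    simpa [p, Polynomial.eval_finsetSum] using ht
  let x : Fin (n + 1) → ℂ := fun m => if m = k then 1 else if m = l then t else 0
  have hxk : x k = 1 := if_pos rfl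
  have hxl : x l = t := by simp [x, hlk]
  have hx0 : ∀ m, m ≠ k → m ≠ l → x m = 0 := fun m h1 h2 => by simp [x, h1, h2]
  have hxj : x κ = 0 := hx0 κ hkj.symm hlj.symm
  have hx : x ≠ 0 := fun h => by
    rw [h] at hxk
    exact zero_ne_one hxk
  refine hx ((hA.nondegenerate _).1 ⟨?_, fun m => ?_⟩)
  · rw [eval_poly]
    exact Finset.sum_eq_zero fun i _ => Finset.prod_eq_zero (Finset.mem_univ κ)
      (by rw [hxj, zero_pow (hfull i)])
  · rw [eval_pderiv_poly]
    by_cases hm : m = κ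
    · subst hm
      rw [← hsum, ← Finset.sum_subset (Finset.subset_univ I)]
      · refine Finset.sum_congr rfl fun i hi => ?_
        obtain ⟨hi1, hi2⟩ := (Finset.mem_filter.1 hi).2
        rw [hi1, Nat.cast_one, one_mul, Finset.prod_eq_single l]
        · rw [hxl, if_neg hlj, Nat.sub_zero]
        · intro b _ hb
          by_cases hbk : b = k
          · rw [hbk, hxk, one_pow]
          · by_cases hbm : b = m
            · rw [hbm, if_pos rfl, hi1, pow_zero]
            · rw [hi2 b hbm hbk hb, Nat.zero_sub, pow_zero]
        · simp
      · intro i _ hi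
        by_cases hi1 : A i m = 1
        · have : ∃ b, b ≠ m ∧ b ≠ k ∧ b ≠ l ∧ A i b ≠ 0 := by
            by_contra! h
            exact hi (Finset.mem_filter.2 ⟨Finset.mem_univ i, hi1, h⟩)
          obtain ⟨b, hbm, hbk, hbl, hb⟩ := this
          rw [Finset.prod_eq_zero (Finset.mem_univ b), mul_zero]
          rw [hx0 b hbk hbl, if_neg hbm, Nat.sub_zero, zero_pow hb]
        · rw [Finset.prod_eq_zero (Finset.mem_univ m), mul_zero]
          have := hfull i
          rw [hxj, if_pos rfl, zero_pow (by omega)]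
    · refine Finset.sum_eq_zero fun i _ => ?_
      rw [Finset.prod_eq_zero (Finset.mem_univ κ), mul_zero]
      rw [hxj, if_neg (Ne.symm hm), Nat.sub_zero, zero_pow (hfull i)]

/-! ### Density of the torus part -/

theorem not_X_dvd_poly {A : Mat n ℕ} {j : Fin (n + 1)} (h : ∃ i, A i j = 0) : ¬ X j ∣ poly A := by
  rintro ⟨g, hg⟩
  -- At the point with `x_j = 0` and all other coordinates `1`, the value of `F_A` counts the zeros
  -- in column `j`.
  have h1 := congrArg (eval (Function.update (1 : Fin (n + 1) → ℂ) j 0)) hg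
  rw [map_mul, eval_X, Function.update_self, zero_mul, eval_poly] at h1
  have key : ∀ i, ∏ k, Function.update (1 : Fin (n + 1) → ℂ) j 0 k ^ A i k =
      if A i j = 0 then 1 else 0 := fun i => by
    rw [Finset.prod_eq_single j]
    · simp [zero_pow_eq]
    · intro k _ hk
      simp [Function.update_of_ne hk]
    · simp
  simp only [key] at h1
  rw [Finset.sum_boole, Nat.cast_eq_zero] at h1
  obtain ⟨i, hi⟩ := h
  exact Finset.card_ne_zero_of_mem (Finset.mem_filter.2 ⟨Finset.mem_univ i, hi⟩) h1

theorem eval_prod_X_ne_zero_iff {x : Fin (n + 1) → ℂ} :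
    eval x (∏ j, X j) ≠ 0 ↔ ∀ j, x j ≠ 0 := by
  simp [Finset.prod_ne_zero_iff]

/-- Otherwise `R ∏ X_j` vanishes on the zero locus, and by the Nullstellensatz `F_A` divides one of
its powers. Being coprime to every `X_j`, it divides a power of `R`, contradicting `R(x) ≠ 0`.
Irreducibility of `F_A` is not needed. -/
theorem exists_torus_point {A : Mat n ℕ} (hcol : ∀ j, ∃ i, A i j = 0)
    {R : MvPolynomial (Fin (n + 1)) ℂ} {x : Fin (n + 1) → ℂ} (hx : eval x (poly A) = 0)
    (hR : eval x R ≠ 0) :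
    ∃ y : Fin (n + 1) → ℂ, eval y (poly A) = 0 ∧ eval y R ≠ 0 ∧ ∀ j, y j ≠ 0 := by
  by_contra! hcon
  have hmem : R * ∏ j, X j ∈ vanishingIdeal ℂ (zeroLocus ℂ (Ideal.span {poly A})) := by
    rw [mem_vanishingIdeal_iff]
    intro y hy
    rw [zeroLocus_span] at hy
    have hy : eval y (poly A) = 0 := by simpa [coe_aeval_eq_eval] using hy (poly A) rfl
    change eval y _ = 0
    rw [map_mul]
    by_cases hRy : eval y R = 0
    · rw [hRy, zero_mul]
    · obtain ⟨j, hj⟩ := hcon y hy hRy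
      by_contra h
      exact eval_prod_X_ne_zero_iff.1 (right_ne_zero_of_mul h) j hj
  rw [vanishingIdeal_zeroLocus_eq_radical] at hmem
  obtain ⟨k, hk⟩ := hmem
  rw [Ideal.mem_span_singleton, mul_pow] at hk
  have hrel : IsRelPrime (poly A) ((∏ j, X j) ^ k) :=
    IsRelPrime.pow_right (IsRelPrime.prod_right fun j _ =>
      ((((X_prime (R := ℂ) (i := j)).irreducible).isRelPrime_iff_not_dvd).2
        (not_X_dvd_poly (hcol j))).symm)
  obtain ⟨g, hg⟩ := hrel.dvd_of_dvd_mul_right hk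
  have := congrArg (eval x) hg
  rw [map_mul, hx, zero_mul, map_pow] at this
  exact pow_ne_zero k hR this

end BHK

namespace BHK
variable {n : ℕ}

/-! ### Open sets and regular functions in coordinates -/

/-- With coordinates `ι` on `X`: `S` is a union of principal open sets. -/
def ZOpen {X : Type} {m : ℕ} (ι : X → Fin m → ℂ) (S : Set X) : Prop :=
  ∀ x ∈ S, ∃ R : MvPolynomial (Fin m) ℂ, eval (ι x) R ≠ 0 ∧ ∀ y, eval (ι y) R ≠ 0 → y ∈ S

/-- With coordinates `ι` on `X`: near every point of `S`, the function `f` is a quotient of two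
polynomials `P / Q`. Multiplying both by a polynomial that vanishes off a neighbourhood, one may ask
for `f Q = P` on all of `S`. -/
def ZReg {X : Type} {m : ℕ} (ι : X → Fin m → ℂ) (S : Set X) (f : X → ℂ) : Prop :=
  ∀ x ∈ S, ∃ P Q : MvPolynomial (Fin m) ℂ, eval (ι x) Q ≠ 0 ∧
    ∀ y ∈ S, f y * eval (ι y) Q = eval (ι y) P

/-- The affine cone over `X_A`, without the origin. -/
abbrev Cone (A : Mat n ℕ) : Type := {x : Punctured n // eval x.1 (poly A) = 0}

abbrev Cone.coords {A : Mat n ℕ} (x : Cone A) : Fin (n + 1) → ℂ := x.1.1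

/-- The projection of the cone onto the quotient variety. -/
def toOrbifold (A : Mat n ℕ) (w : Fin (n + 1) → ℤ) (K : Subgroup (Torus n)) (x : Cone A) :
    Quotient (orbitSetoid A w K) :=
  Quotient.mk _ ⟨Quotient.mk _ x.1, x.1, rfl, x.2⟩

theorem toOrbifold_surjective (A : Mat n ℕ) (w : Fin (n + 1) → ℤ) (K : Subgroup (Torus n)) :
    Function.Surjective (toOrbifold A w K) := by
  rintro ⟨⟨_, x, rfl, hx⟩⟩
  exact ⟨⟨x, hx⟩, rfl⟩

theorem mk_eq_mk_iff {w : Fin (n + 1) → ℤ} {x y : Punctured n} :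
    (Quotient.mk (MulAction.orbitRel (scaling w) (Punctured n)) x = Quotient.mk _ y) ↔
      ∃ c ∈ scaling w, c • y = x := by
  rw [Quotient.eq, MulAction.orbitRel_apply]
  exact ⟨fun ⟨c, hc⟩ => ⟨c, c.2, hc⟩, fun ⟨c, hc, h⟩ => ⟨⟨c, hc⟩, h⟩⟩

theorem toOrbifold_eq_iff {A : Mat n ℕ} {w : Fin (n + 1) → ℤ} {K : Subgroup (Torus n)}
    {x y : Cone A} : toOrbifold A w K x = toOrbifold A w K y ↔
      ∃ k ∈ K, ∃ c ∈ scaling w, (c * k) • x.1 = y.1 := by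
  unfold toOrbifold
  rw [Quotient.eq]
  constructor
  · rintro ⟨⟨k⟩, h⟩
    change Quotient.mk _ ((k : Torus n) • x.1) = Quotient.mk _ y.1 at h
    obtain ⟨c, hc, h⟩ := mk_eq_mk_iff.1 h.symm
    exact ⟨k, k.2, c, hc, by rw [mul_smul, h]⟩
  · rintro ⟨k, hk, c, hc, h⟩
    refine ⟨QuotientGroup.mk ⟨k, hk⟩, ?_⟩
    change Quotient.mk _ (k • x.1) = Quotient.mk _ y.1
    exact (mk_eq_mk_iff.2 ⟨c, hc, by rw [← h, mul_smul]⟩).symm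

theorem isOpen_weightedProjectiveSpace {w : Fin (n + 1) → ℤ} {O : Set (WPoint w)} :
    IsOpen[(weightedProjectiveSpace w).top] O ↔
      ∃ S : Set (MvPolynomial (Fin (n + 1)) ℂ), ∀ x : Punctured n,
        (Quotient.mk _ x ∈ O ↔ ∃ P ∈ S, eval x.1 P ≠ 0) := by
  constructor
  · rintro ⟨_, ⟨S, rfl⟩, h⟩
    exact ⟨S, fun x => (Set.ext_iff.1 h x).symm⟩
  · rintro ⟨S, hS⟩
    exact ⟨_, ⟨S, rfl⟩, Set.ext fun x => (hS x).symm⟩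

/-- `w` is a system of weights for `F_A`. -/
def IsWeight (A : Mat n ℕ) (w : Fin (n + 1) → ℤ) : Prop :=
  ∃ δ : ℤ, ∀ i, ∑ j, (A i j : ℤ) * w j = δ

theorem prod_zpow_eq_zpow_sum {ι G : Type*} [CommGroup G] (s : Finset ι) (a : G) (f : ι → ℤ) :
    ∏ i ∈ s, a ^ f i = a ^ ∑ i ∈ s, f i := by
  classical
  induction s using Finset.induction_on with
  | empty => simp
  | insert i s hi ih => rw [Finset.prod_insert hi, Finset.sum_insert hi, zpow_add, ih]

theorem IsWeight.eval_smul_eq_zero {A : Mat n ℕ} {w : Fin (n + 1) → ℤ} (hw : IsWeight A w)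
    {c : Torus n} (hc : c ∈ scaling w) {x : Fin (n + 1) → ℂ} (hx : eval x (poly A) = 0) :
    eval (fun j => (c j : ℂ) * x j) (poly A) = 0 := by
  obtain ⟨δ, hδ⟩ := hw
  obtain ⟨μ, hμ⟩ := hc
  rw [eval_poly] at hx
  rw [eval_poly, ← mul_zero ((μ : ℂ) ^ δ), ← hx, Finset.mul_sum]
  refine Finset.sum_congr rfl fun i _ => ?_
  simp only [mul_pow, Finset.prod_mul_distrib]
  congr 1
  rw [← Units.val_zpow_eq_zpow_val, ← hδ i, ← prod_zpow_eq_zpow_sum, Units.coe_prod]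
  refine Finset.prod_congr rfl fun j _ => ?_
  rw [hμ j, ← Units.val_pow_eq_pow_val, ← zpow_natCast, ← zpow_mul, mul_comm]

/-- The action of the scaling group on the cone. -/
def Cone.scale {A : Mat n ℕ} {w : Fin (n + 1) → ℤ} (hw : IsWeight A w)
    (c : scaling w) (x : Cone A) : Cone A :=
  ⟨(c : Torus n) • x.1, hw.eval_smul_eq_zero c.2 x.2⟩

theorem toOrbifold_scale {A : Mat n ℕ} {w : Fin (n + 1) → ℤ} (K : Subgroup (Torus n))
    (hw : IsWeight A w) (c : scaling w) (x : Cone A) :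
    toOrbifold A w K (x.scale hw c) = toOrbifold A w K x :=
  (toOrbifold_eq_iff.2 ⟨1, one_mem _, c, c.2, by rw [mul_one]; rfl⟩).symm

theorem exists_substitution (c : Torus n) (R : MvPolynomial (Fin (n + 1)) ℂ) :
    ∃ R' : MvPolynomial (Fin (n + 1)) ℂ, ∀ x : Fin (n + 1) → ℂ,
      eval x R' = eval (fun j => (c j : ℂ) * x j) R :=
  ⟨bind₁ (fun j => C (c j : ℂ) * X j) R, fun x => by
    rw [eval, eval₂Hom_bind₁]
    simp only [map_mul, eval₂Hom_C, eval₂Hom_X', RingHom.id_apply]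
    rfl⟩

theorem isOpen_orbifold_iff {A : Mat n ℕ} {w : Fin (n + 1) → ℤ} (hw : IsWeight A w)
    (K : Subgroup (Torus n)) (V : Set (Quotient (orbitSetoid A w K))) :
    IsOpen[(orbifold A w K).top] V ↔ ZOpen Cone.coords (toOrbifold A w K ⁻¹' V) := by
  constructor
  · rintro ⟨O, hO, hOV⟩ x hx
    obtain ⟨S, hS⟩ := isOpen_weightedProjectiveSpace.1 hO
    have hmem : ∀ z : Cone A, toOrbifold A w K z ∈ V ↔ ∃ P ∈ S, eval z.coords P ≠ 0 := fun z =>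
      (Set.ext_iff.1 hOV ⟨Quotient.mk _ z.1, z.1, rfl, z.2⟩).symm.trans (hS z.1)
    obtain ⟨P, hP, hPx⟩ := (hmem x).1 hx
    exact ⟨P, hPx, fun y hy => (hmem y).2 ⟨P, hP, hy⟩⟩
  · intro h
    -- Polynomials are tested on cone points only. Since the preimage of `V` is invariant under
    -- scaling, `S` is stable under the substitutions `x ↦ c x`, so the union of the sets `R ≠ 0`
    -- descends to the weighted projective space.
    let S : Set (MvPolynomial (Fin (n + 1)) ℂ) :=
      {R | ∀ z : Cone A, eval z.coords R ≠ 0 → toOrbifold A w K z ∈ V}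
    let O : Set (WPoint w) := Quotient.mk _ '' {x : Punctured n | ∃ R ∈ S, eval x.1 R ≠ 0}
    have hO : ∀ x : Punctured n, Quotient.mk _ x ∈ O ↔ ∃ R ∈ S, eval x.1 R ≠ 0 := by
      refine fun x => ⟨?_, fun h => ⟨x, h, rfl⟩⟩
      rintro ⟨y, ⟨R, hR, hRy⟩, hxy⟩
      obtain ⟨c, hc, rfl⟩ := mk_eq_mk_iff.1 hxy
      obtain ⟨R', hR'⟩ := exists_substitution c R
      refine ⟨R', fun z hz => ?_, by rw [hR']; exact hRy⟩
      rw [hR'] at hz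
      rw [← toOrbifold_scale K hw ⟨c, hc⟩ z]
      exact hR (z.scale hw ⟨c, hc⟩) hz
    refine ⟨O, isOpen_weightedProjectiveSpace.2 ⟨S, hO⟩, Set.ext ?_⟩
    rintro ⟨_, x, rfl, hx⟩
    refine (hO x).trans ⟨fun ⟨R, hR, hRx⟩ => hR ⟨x, hx⟩ hRx, fun hxV => ?_⟩
    obtain ⟨R, hRx, hR⟩ := h ⟨x, hx⟩ hxV
    exact ⟨R, hR, hRx⟩

theorem isOpen_zariski_ne_zero {m : ℕ} (R : MvPolynomial (Fin m) ℂ) :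
    IsOpen[FunSpace.zariski m] {x | eval x R ≠ 0} :=
  ⟨{R}, by simp⟩

theorem reg_orbifold_iff {A : Mat n ℕ} {w : Fin (n + 1) → ℤ} (hw : IsWeight A w)
    (K : Subgroup (Torus n)) {V : Set (Quotient (orbitSetoid A w K))}
    (f : Quotient (orbitSetoid A w K) → ℂ) :
    (orbifold A w K).Reg V f ↔
      ZReg Cone.coords (toOrbifold A w K ⁻¹' V) (fun x => f (toOrbifold A w K x)) := by
  constructor
  · intro h x hx
    obtain ⟨U, F, hU, hxU, hF, hfF⟩ := h ⟨Quotient.mk _ x.1, x.1, rfl, x.2⟩ hx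
    obtain ⟨S, hS⟩ := isOpen_weightedProjectiveSpace.1 hU
    obtain ⟨R, hRS, hRx⟩ := (hS x.1).1 hxU
    obtain ⟨W, F', hW, hxW, hF', hFF'⟩ := hF x.1 hxU
    obtain ⟨W', ⟨T, rfl⟩, ⟨R', hRT, hRx'⟩, hWW', P, Q, hPQ⟩ := hF' x.1.1 hxW
    -- The factors `R` and `R'` vanish where the local expression `P / Q` is not known to be valid,
    -- making the equation true on the whole preimage of `V`.
    refine ⟨R * R' * P, R * R' * Q, ?_, fun y hy => ?_⟩
    · rw [map_mul, map_mul]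
      exact mul_ne_zero (mul_ne_zero hRx hRx') (hPQ _ ⟨R', hRT, hRx'⟩).1
    · simp only [map_mul]
      by_cases h1 : eval y.coords R = 0
      · simp [h1]
      by_cases h2 : eval y.coords R' = 0
      · simp [h2]
      have hyU : Quotient.mk _ y.1 ∈ U := (hS y.1).2 ⟨R, hRS, h1⟩
      have hyW : y.coords ∈ {x | ∃ P ∈ T, eval x P ≠ 0} := ⟨R', hRT, h2⟩
      obtain ⟨hQ, hval⟩ := hPQ _ hyW
      have hfy : f (toOrbifold A w K y) = eval y.coords P / eval y.coords Q :=
        ((hfF ⟨Quotient.mk _ y.1, y.1, rfl, y.2⟩ hy hyU).trans (hFF' y.1 hyU (hWW' hyW))).trans hval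
      rw [hfy]
      field_simp
  · rintro h ⟨_, x, rfl, hx⟩ hxV
    obtain ⟨P, Q, hQx, hPQ⟩ := h ⟨x, hx⟩ hxV
    -- Replacing `P` and `Q` by their components for one common character makes the quotient `P' /
    -- Q'` invariant under scaling, hence a function on the weighted projective space.
    obtain ⟨χ, hχ⟩ := exists_eval_component_ne_zero (scaling w) hQx
    have hcomp : ∀ y : Cone A, toOrbifold A w K y ∈ V → f (toOrbifold A w K y) *
        eval y.coords (component (scaling w) χ Q) = eval y.coords (component (scaling w) χ P) := by
      intro y hy
      refine mul_eval_component_eq _ (fun c hc => ?_) χ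
      have hc' := toOrbifold_scale K hw ⟨c, hc⟩ y
      rw [← hc']
      exact hPQ (y.scale hw ⟨c, hc⟩) (by rw [Set.mem_preimage, hc']; exact hy)
    set P' := component (scaling w) χ P with hP'
    set Q' := component (scaling w) χ Q with hQ'
    have hχne : ∀ c : scaling w, χ.toMul c ≠ 0 := fun c => by
      have := map_mul χ.toMul c c⁻¹
      rw [mul_inv_cancel, map_one] at this
      exact left_ne_zero_of_mul (this ▸ one_ne_zero)
    let F : WPoint w → ℂ := Quotient.lift (fun y : Punctured n => eval y.1 P' / eval y.1 Q') <| by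
      rintro _ y ⟨c, rfl⟩
      change eval (fun j => ((c : Torus n) j : ℂ) * y.1 j) P' /
        eval (fun j => ((c : Torus n) j : ℂ) * y.1 j) Q' = _
      rw [hP', hQ', eval_smul_component, eval_smul_component, mul_div_mul_left _ _ (hχne c)]
    let U : Set (WPoint w) := Quotient.mk _ '' {y : Punctured n | eval y.1 Q' ≠ 0}
    have hU : ∀ y : Punctured n, Quotient.mk _ y ∈ U ↔ eval y.1 Q' ≠ 0 := by
      refine fun y => ⟨?_, fun h => ⟨y, h, rfl⟩⟩
      rintro ⟨z, hz, hzy⟩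
      obtain ⟨c, hc, rfl⟩ := mk_eq_mk_iff.1 hzy
      have hz : eval (fun j => (c j : ℂ) * y.1 j) Q' ≠ 0 := hz
      rw [hQ', eval_smul_component (scaling w) Q χ ⟨c, hc⟩] at hz
      exact right_ne_zero_of_mul hz
    refine ⟨U, F, isOpen_weightedProjectiveSpace.2 ⟨{Q'}, by simpa using hU⟩, (hU x).2 hχ,
      fun y hy => ⟨_, fun z => eval z P' / eval z Q', isOpen_zariski_ne_zero Q', (hU y).1 hy,
        fun z hz => ⟨_, isOpen_zariski_ne_zero Q', hz, subset_rfl, P', Q', fun u hu => ⟨hu, rfl⟩⟩,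
        fun z _ _ => rfl⟩, ?_⟩
    rintro ⟨_, y, rfl, hy⟩ hyV hyU
    exact (eq_div_iff ((hU y).1 hyU)).2 (hcomp ⟨y, hy⟩ hyV)

end BHK

/-- An isomorphism of quotients `p : P → X` and `q : Q → Y` induced by a map `φ : Q → P`, when open
sets and regular functions on all sides are described in coordinates on `P` and `Q`. -/
theorem FunSpace.iso_of_surjective {X Y P Q : Type} {m k : ℕ} {s : FunSpace X} {t : FunSpace Y}
    {p : P → X} {q : Q → Y} {φ : Q → P} {ι : P → Fin m → ℂ} {κ : Q → Fin k → ℂ}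
    (hp : Function.Surjective p) (hq : Function.Surjective q) (hφ : Function.Surjective φ)
    (hs : ∀ V, IsOpen[s.top] V ↔ BHK.ZOpen ι (p ⁻¹' V))
    (hs' : ∀ V, IsOpen[s.top] V → ∀ f, s.Reg V f ↔ BHK.ZReg ι (p ⁻¹' V) (f ∘ p))
    (ht : ∀ V, IsOpen[t.top] V ↔ BHK.ZOpen κ (q ⁻¹' V))
    (ht' : ∀ V, IsOpen[t.top] V → ∀ f, t.Reg V f ↔ BHK.ZReg κ (q ⁻¹' V) (f ∘ q))
    (ho : ∀ S, BHK.ZOpen ι S ↔ BHK.ZOpen κ (φ ⁻¹' S))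
    (hr : ∀ S f, BHK.ZReg ι S f ↔ BHK.ZReg κ (φ ⁻¹' S) (f ∘ φ))
    (heq : ∀ a b, p (φ a) = p (φ b) ↔ q a = q b) : FunSpace.Iso s t := by
  -- By `heq` the maps `p ∘ φ` and `q` have the same fibres, so the chosen lift is immaterial.
  let g : Y → X := fun y => p (φ (Function.surjInv hq y))
  have hg : ∀ a, g (q a) = p (φ a) := fun a => (heq _ _).2 (Function.surjInv_eq hq _)
  have hbij : Function.Bijective g := by
    constructor
    · intro y y' h
      obtain ⟨a, rfl⟩ := hq y
      obtain ⟨b, rfl⟩ := hq y'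
      rw [hg, hg] at h
      exact (heq _ _).1 h
    · intro x
      obtain ⟨z, rfl⟩ := hp x
      obtain ⟨a, rfl⟩ := hφ z
      exact ⟨q a, hg a⟩
  let e : X ≃ Y := (Equiv.ofBijective g hbij).symm
  have he : ∀ a, e (p (φ a)) = q a := fun a =>
    (Equiv.ofBijective g hbij).symm_apply_eq.2 (hg a).symm
  have hpre : ∀ V : Set Y, φ ⁻¹' (p ⁻¹' (e ⁻¹' V)) = q ⁻¹' V := fun V => by
    ext a
    simp only [Set.mem_preimage, he]
  have hopen : ∀ V : Set Y, IsOpen[t.top] V ↔ IsOpen[s.top] (e ⁻¹' V) := fun V => by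
    rw [hs, ho, hpre, ht]
  refine ⟨e, hopen, fun V hV f => ?_⟩
  rw [ht' V hV, hs' _ ((hopen V).1 hV), hr, hpre]
  have : ((fun x => f (e x)) ∘ p) ∘ φ = f ∘ q := funext fun a => congrArg f (he a)
  rw [this]

namespace BHK
variable {n : ℕ}

/-! ### The torus part of the quotient variety -/

/-- The points of the cone over `X_A` with nonzero coordinates. -/
abbrev TorusCone (A : Mat n ℕ) : Type :=
  {t : Torus n // eval (fun j => (t j : ℂ)) (poly A) = 0}

abbrev TorusCone.coords {A : Mat n ℕ} (t : TorusCone A) : Fin (n + 1) → ℂ := fun j => (t.1 j : ℂ)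

def TorusCone.toCone {A : Mat n ℕ} (t : TorusCone A) : Cone A :=
  ⟨⟨t.coords, fun h => (t.1 0).ne_zero (congrFun (Set.mem_singleton_iff.1 h) 0)⟩, t.2⟩

theorem TorusCone.exists_toCone_eq {A : Mat n ℕ} {x : Cone A} (hx : ∀ j, x.coords j ≠ 0) :
    ∃ t : TorusCone A, t.toCone = x :=
  ⟨⟨fun j => Units.mk0 _ (hx j), x.2⟩, rfl⟩

/-- The points of the quotient variety with nonzero coordinates. -/
def torusPart (A : Mat n ℕ) (w : Fin (n + 1) → ℤ) (K : Subgroup (Torus n)) :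
    Set (Quotient (orbitSetoid A w K)) :=
  Set.range fun t : TorusCone A => toOrbifold A w K t.toCone

def toTorusPart (A : Mat n ℕ) (w : Fin (n + 1) → ℤ) (K : Subgroup (Torus n)) (t : TorusCone A) :
    torusPart A w K :=
  ⟨toOrbifold A w K t.toCone, t, rfl⟩

variable {A : Mat n ℕ} {w : Fin (n + 1) → ℤ} {K : Subgroup (Torus n)}

theorem toTorusPart_surjective : Function.Surjective (toTorusPart A w K) := by
  rintro ⟨_, t, rfl⟩
  exact ⟨t, rfl⟩

theorem toTorusPart_eq_iff {s t : TorusCone A} :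
    toTorusPart A w K s = toTorusPart A w K t ↔
      ∃ k ∈ K, ∃ c ∈ scaling w, c * k * s.1 = t.1 := by
  rw [Subtype.ext_iff]
  change toOrbifold A w K s.toCone = toOrbifold A w K t.toCone ↔ _
  rw [toOrbifold_eq_iff]
  refine exists_congr fun k => and_congr_right fun _ => exists_congr fun c =>
    and_congr_right fun _ => ⟨fun h => ?_, fun h => ?_⟩
  · funext j
    ext
    have := congrFun (congrArg Subtype.val h) j
    change (((c * k) j : ℂˣ) : ℂ) * (s.1 j : ℂ) = (t.1 j : ℂ) at this
    rw [← this, Pi.mul_apply (c * k), Units.val_mul]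
  · refine Subtype.ext (funext fun j => ?_)
    change (((c * k) j : ℂˣ) : ℂ) * (s.1 j : ℂ) = (t.1 j : ℂ)
    rw [← h, Pi.mul_apply (c * k), Units.val_mul]

theorem toOrbifold_mem_torusPart_iff {x : Cone A} :
    toOrbifold A w K x ∈ torusPart A w K ↔ ∀ j, x.coords j ≠ 0 := by
  constructor
  · rintro ⟨t, ht⟩ j
    obtain ⟨k, -, c, -, h⟩ := toOrbifold_eq_iff.1 ht
    rw [Cone.coords, ← h]
    change (((c * k) j : ℂˣ) : ℂ) * (t.1 j : ℂ) ≠ 0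
    exact mul_ne_zero (Units.ne_zero _) (Units.ne_zero _)
  · intro h
    obtain ⟨t, rfl⟩ := TorusCone.exists_toCone_eq h
    exact ⟨t, rfl⟩

theorem isOpen_torusPart (hw : IsWeight A w) : IsOpen[(orbifold A w K).top] (torusPart A w K) :=
  (isOpen_orbifold_iff hw K _).2 fun _ hx =>
    ⟨∏ j, X j, eval_prod_X_ne_zero_iff.2 (toOrbifold_mem_torusPart_iff.1 hx), fun _ hy =>
      toOrbifold_mem_torusPart_iff.2 (eval_prod_X_ne_zero_iff.1 hy)⟩

theorem dense_torusPart (hw : IsWeight A w) (hcol : ∀ j, ∃ i, A i j = 0) :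
    @Dense _ (orbifold A w K).top (torusPart A w K) := by
  let := (orbifold A w K).top
  rw [dense_iff_inter_open]
  rintro V hV ⟨p, hp⟩
  obtain ⟨x, rfl⟩ := toOrbifold_surjective A w K p
  obtain ⟨R, hRx, hR⟩ := (isOpen_orbifold_iff hw K V).1 hV x hp
  obtain ⟨y, hy, hRy, hy0⟩ := exists_torus_point hcol x.2 hRx
  let t : TorusCone A := ⟨fun j => Units.mk0 _ (hy0 j), hy⟩
  exact ⟨toOrbifold A w K t.toCone, hR t.toCone hRy, t, rfl⟩

theorem isOpen_image_torusPart (hw : IsWeight A w) {V : Set (torusPart A w K)}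
    (hV : ZOpen TorusCone.coords (toTorusPart A w K ⁻¹' V)) :
    IsOpen[(orbifold A w K).top] (Subtype.val '' V) := by
  rw [isOpen_orbifold_iff hw]
  intro x hx
  obtain ⟨v, hv, hvx⟩ := id hx
  obtain ⟨t, rfl⟩ := TorusCone.exists_toCone_eq
    (toOrbifold_mem_torusPart_iff.1 (hvx ▸ v.2 : toOrbifold A w K x ∈ _))
  obtain rfl : v = toTorusPart A w K t := Subtype.ext hvx
  obtain ⟨R, hRt, hR⟩ := hV t hv
  -- The product of the variables cuts the torus out of the cone.
  refine ⟨R * ∏ j, X j, ?_, fun y hy => ?_⟩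
  · rw [map_mul]
    exact mul_ne_zero hRt (eval_prod_X_ne_zero_iff.2 fun j => (t.1 j).ne_zero)
  · rw [map_mul] at hy
    obtain ⟨t', rfl⟩ := TorusCone.exists_toCone_eq
      (eval_prod_X_ne_zero_iff.1 (right_ne_zero_of_mul hy))
    exact ⟨toTorusPart A w K t', hR t' (left_ne_zero_of_mul hy), rfl⟩

theorem isOpen_torusPart_iff (hw : IsWeight A w) (V : Set (torusPart A w K)) :
    IsOpen[((orbifold A w K).restrict (torusPart A w K)).top] V ↔
      ZOpen TorusCone.coords (toTorusPart A w K ⁻¹' V) := by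
  constructor
  · rintro ⟨O, hO, rfl⟩ t ht
    obtain ⟨R, hRt, hR⟩ := (isOpen_orbifold_iff hw K O).1 hO t.toCone ht
    exact ⟨R, hRt, fun y hy => hR y.toCone hy⟩
  · exact fun hV => ⟨_, isOpen_image_torusPart hw hV,
      Set.preimage_image_eq _ Subtype.val_injective⟩

theorem reg_torusPart_iff (hw : IsWeight A w) (V : Set (torusPart A w K))
    (hV : IsOpen[((orbifold A w K).restrict (torusPart A w K)).top] V) (f : torusPart A w K → ℂ) :
    ((orbifold A w K).restrict (torusPart A w K)).Reg V f ↔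
      ZReg TorusCone.coords (toTorusPart A w K ⁻¹' V) (f ∘ toTorusPart A w K) := by
  classical
  constructor
  · intro h t ht
    obtain ⟨U, F, hU, htU, hF, hfF⟩ := h _ ht
    obtain ⟨R, hRt, hR⟩ := (isOpen_orbifold_iff hw K U).1 hU t.toCone htU
    obtain ⟨P, Q, hQt, hPQ⟩ := (reg_orbifold_iff hw K F).1 hF t.toCone htU
    refine ⟨R * P, R * Q, by rw [map_mul]; exact mul_ne_zero hRt hQt, fun y hy => ?_⟩
    simp only [map_mul]
    by_cases h0 : eval y.coords R = 0
    · simp [h0]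
    have hyU := hR y.toCone h0
    have h1 : f (toTorusPart A w K y) = F (toOrbifold A w K y.toCone) := hfF _ hy hyU
    rw [Function.comp_apply, h1, mul_left_comm]
    exact congrArg (_ * ·) (hPQ y.toCone hyU)
  · intro h v hv
    -- The value `0` off the torus part plays no role: `F` is only used on the image of `V`.
    let F : Quotient (orbitSetoid A w K) → ℂ :=
      fun p => if hp : p ∈ torusPart A w K then f ⟨p, hp⟩ else 0
    have hFf : ∀ z : torusPart A w K, F z = f z := fun z => dif_pos z.2
    refine ⟨Subtype.val '' V, F, isOpen_image_torusPart hw ((isOpen_torusPart_iff hw V).1 hV),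
      ⟨v, hv, rfl⟩, (reg_orbifold_iff hw K F).2 ?_, fun z _ _ => (hFf z).symm⟩
    have hlift : ∀ x : Cone A, toOrbifold A w K x ∈ Subtype.val '' V →
        ∃ t : TorusCone A, t.toCone = x ∧ toTorusPart A w K t ∈ V := by
      rintro x ⟨u, hu, hux⟩
      obtain ⟨t, rfl⟩ := TorusCone.exists_toCone_eq
        (toOrbifold_mem_torusPart_iff.1 (hux ▸ u.2 : toOrbifold A w K x ∈ _))
      exact ⟨t, rfl, (Subtype.ext hux : u = toTorusPart A w K t) ▸ hu⟩
    intro x hx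
    obtain ⟨t, rfl, ht⟩ := hlift x hx
    obtain ⟨P, Q, hQ, hPQ⟩ := h t ht
    refine ⟨P, Q, hQ, fun y hy => ?_⟩
    obtain ⟨t', rfl, ht'⟩ := hlift y hy
    exact (congrArg (· * _) (hFf (toTorusPart A w K t'))).trans (hPQ t' ht')

end BHK

namespace BHK
variable {n : ℕ}

/-! ### Laurent polynomials on the torus -/

/-- Functions on the torus given by Laurent polynomials. -/
def IsLaurent (f : Torus n → ℂ) : Prop :=
  ∃ (v : Fin (n + 1) → ℕ) (P : MvPolynomial (Fin (n + 1)) ℂ),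
    ∀ y : Torus n, eval (fun j => (y j : ℂ)) P = monomialChar v y * f y

theorem monomialChar_add (v v' : Fin (n + 1) → ℕ) (y : Torus n) :
    monomialChar (v + v') y = monomialChar v y * monomialChar v' y := by
  simp [monomialChar_apply, pow_add, Finset.prod_mul_distrib]

theorem monomialChar_ne_zero (v : Fin (n + 1) → ℕ) (y : Torus n) : monomialChar v y ≠ 0 := by
  rw [monomialChar_apply]
  exact Finset.prod_ne_zero_iff.2 fun j _ => pow_ne_zero _ (y j).ne_zero

theorem exists_eval_eq_monomialChar_mul (v : Fin (n + 1) → ℕ)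
    (P : MvPolynomial (Fin (n + 1)) ℂ) :
    ∃ P' : MvPolynomial (Fin (n + 1)) ℂ, ∀ y : Torus n,
      eval (fun j => (y j : ℂ)) P' = monomialChar v y * eval (fun j => (y j : ℂ)) P :=
  ⟨(∏ j, X j ^ v j) * P, fun y => by simp [monomialChar_apply]⟩

theorem IsLaurent.common_denominator {f g : Torus n → ℂ} (hf : IsLaurent f) (hg : IsLaurent g) :
    ∃ (v : Fin (n + 1) → ℕ) (P Q : MvPolynomial (Fin (n + 1)) ℂ), ∀ y : Torus n,
      eval (fun j => (y j : ℂ)) P = monomialChar v y * f y ∧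
        eval (fun j => (y j : ℂ)) Q = monomialChar v y * g y := by
  obtain ⟨v, P, hP⟩ := hf
  obtain ⟨v', Q, hQ⟩ := hg
  obtain ⟨P', hP'⟩ := exists_eval_eq_monomialChar_mul v' P
  obtain ⟨Q', hQ'⟩ := exists_eval_eq_monomialChar_mul v Q
  refine ⟨v + v', P', Q', fun y => ⟨?_, ?_⟩⟩
  · rw [hP', hP, monomialChar_add]
    ring
  · rw [hQ', hQ, monomialChar_add]
    ring

theorem IsLaurent.add {f g : Torus n → ℂ} (hf : IsLaurent f) (hg : IsLaurent g) :
    IsLaurent fun y => f y + g y := by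
  obtain ⟨v, P, Q, h⟩ := hf.common_denominator hg
  exact ⟨v, P + Q, fun y => by rw [map_add, (h y).1, (h y).2, mul_add]⟩

theorem IsLaurent.sum {ι : Type*} (s : Finset ι) {f : ι → Torus n → ℂ}
    (h : ∀ i, IsLaurent (f i)) : IsLaurent fun y => ∑ i ∈ s, f i y := by
  classical
  induction s using Finset.induction_on with
  | empty => exact ⟨0, 0, fun y => by simp⟩
  | insert i s hi ih =>
    simp only [Finset.sum_insert hi]
    exact (h i).add ih

theorem isLaurent_zpow (c : ℂ) (u : Fin (n + 1) → ℤ) :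
    IsLaurent fun y : Torus n => c * ((∏ j, y j ^ u j : ℂˣ) : ℂ) := by
  refine ⟨fun j => (-u j).toNat, C c * ∏ j, X j ^ (u j).toNat, fun y => ?_⟩
  rw [map_mul, eval_C, map_prod, mul_left_comm, monomialChar_apply, Units.coe_prod,
    ← Finset.prod_mul_distrib]
  congr 1
  refine Finset.prod_congr rfl fun j _ => ?_
  rw [map_pow, eval_X, ← Units.val_pow_eq_pow_val, ← Units.val_pow_eq_pow_val, ← Units.val_mul,
    ← zpow_natCast, ← zpow_natCast, ← zpow_add]
  congr 2
  omega

/-! ### Monomial maps -/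

theorem shioda_apply (M : Mat n ℤ) (y : Torus n) (j : Fin (n + 1)) :
    shioda M y j = ∏ k, y k ^ M j k := rfl

theorem prod_shioda_zpow (M : Mat n ℤ) (y : Torus n) (u : Fin (n + 1) → ℤ) :
    ∏ j, shioda M y j ^ u j = ∏ k, y k ^ Matrix.vecMul u M k := by
  simp only [shioda_apply, ← Finset.prod_zpow, ← zpow_mul]
  rw [Finset.prod_comm]
  refine Finset.prod_congr rfl fun k _ => ?_
  rw [prod_zpow_eq_zpow_sum]
  simp [Matrix.vecMul, dotProduct, mul_comm]

theorem shioda_mul (M M' : Mat n ℤ) (y : Torus n) :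
    shioda (M * M') y = shioda M (shioda M' y) := by
  funext i
  rw [shioda_apply, shioda_apply, prod_shioda_zpow]
  rfl

theorem shioda_smul_one (N : ℤ) (y : Torus n) : shioda (N • (1 : Mat n ℤ)) y = y ^ N := by
  funext j
  rw [shioda_apply, Finset.prod_eq_single j]
  · simp
  · intro k _ hk
    simp [Matrix.one_apply_ne hk.symm]
  · simp

theorem shioda_smul (e : ℤ) (M : Mat n ℤ) (y : Torus n) : shioda (e • M) y = shioda M y ^ e := by
  rw [← shioda_smul_one e (shioda M y), ← shioda_mul, smul_mul_assoc, one_mul]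

/-- A matrix of exponents, with integer entries. -/
abbrev toInt (A : Mat n ℕ) : Mat n ℤ := A.map (Nat.cast : ℕ → ℤ)

theorem shioda_toInt (A : Mat n ℕ) (t : Torus n) (i : Fin (n + 1)) :
    shioda (toInt A) t i = ∏ j, t j ^ A i j := by
  simp [shioda_apply]

theorem eval_poly_torus (A : Mat n ℕ) (t : Torus n) :
    eval (fun j => (t j : ℂ)) (poly A) = ∑ i, (shioda (toInt A) t i : ℂ) := by
  simp [eval_poly, shioda_toInt]

theorem toInt_fermat (n N : ℕ) : toInt (fermat n N) = (N : ℤ) • (1 : Mat n ℤ) := by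
  ext i j
  rw [toInt, Matrix.map_apply, fermat, Matrix.smul_apply, Matrix.smul_apply, Matrix.one_apply,
    Matrix.one_apply]
  split_ifs <;> simp

theorem mem_Aut_iff_shioda {A : Mat n ℕ} (hA : Function.Injective A) {t : Torus n} :
    t ∈ Aut A ↔ shioda (toInt A) t = 1 := by
  rw [mem_Aut_iff hA, funext_iff]
  simp only [shioda_toInt, Pi.one_apply]

theorem exists_units_pow_eq {N : ℕ} (hN : 0 < N) (a : ℂˣ) : ∃ b : ℂˣ, b ^ N = a := by
  obtain ⟨b, hb⟩ := IsAlgClosed.exists_pow_nat_eq (a : ℂ) hN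
  refine ⟨Units.mk0 b ?_, Units.ext hb⟩
  rintro rfl
  rw [zero_pow hN.ne'] at hb
  exact a.ne_zero hb.symm

theorem shioda_surjective {M M' : Mat n ℤ} {N : ℕ} (hN : 0 < N)
    (h : M * M' = (N : ℤ) • (1 : Mat n ℤ)) : Function.Surjective (shioda M) := by
  intro x
  choose b hb using fun j => exists_units_pow_eq hN (x j)
  refine ⟨shioda M' b, ?_⟩
  rw [← shioda_mul, h, shioda_smul_one, zpow_natCast]
  exact funext hb

/-! ### Roots of unity -/

/-- The root of unity `e^{2πi/d}`. -/
def zeta (d : ℕ) : ℂˣ := Units.mk0 (Complex.exp (2 * Real.pi * Complex.I / d)) (Complex.exp_ne_zero _)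

theorem pr_apply (d : ℕ) (h : Fin (n + 1) → ℤ) (j : Fin (n + 1)) : pr d h j = zeta d ^ h j := by
  ext
  rw [Units.val_zpow_eq_zpow_val, zeta, Units.val_mk0, ← Complex.exp_int_mul]
  simp only [pr, Units.val_mk0]
  congr 1
  ring

theorem isPrimitiveRoot_zeta {d : ℕ} (hd : 0 < d) : IsPrimitiveRoot (zeta d) d :=
  IsPrimitiveRoot.coe_units_iff.1 (Complex.isPrimitiveRoot_exp d hd.ne')

theorem prod_pr_zpow (d : ℕ) (h u : Fin (n + 1) → ℤ) :
    ∏ k, pr d h k ^ u k = zeta d ^ (u ⬝ᵥ h) := by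
  simp only [pr_apply, ← zpow_mul]
  rw [prod_zpow_eq_zpow_sum]
  simp [dotProduct, mul_comm]

theorem shioda_pr (M : Mat n ℤ) (d : ℕ) (h : Fin (n + 1) → ℤ) :
    shioda M (pr d h) = pr d (M.mulVec h) := by
  funext j
  rw [shioda_apply, prod_pr_zpow, pr_apply]
  rfl

theorem pr_eq_one_iff {d : ℕ} (hd : 0 < d) {h : Fin (n + 1) → ℤ} :
    pr d h = 1 ↔ ∀ j, (d : ℤ) ∣ h j := by
  rw [funext_iff]
  refine forall_congr' fun j => ?_
  rw [pr_apply, Pi.one_apply, (isPrimitiveRoot_zeta hd).zpow_eq_one_iff_dvd]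

theorem exists_pr_eq {d : ℕ} (hd : 0 < d) {t : Torus n} (ht : t ^ d = 1) : ∃ h, pr d h = t := by
  have : NeZero d := ⟨hd.ne'⟩
  have : ∀ j, ∃ i : ℤ, zeta d ^ i = t j := fun j => by
    have hj : t j ∈ Subgroup.zpowers (zeta d) := by
      rw [(isPrimitiveRoot_zeta hd).zpowers_eq, mem_rootsOfUnity]
      exact congrFun ht j
    exact Subgroup.mem_zpowers_iff.1 hj
  choose h hh using this
  exact ⟨h, funext fun j => (pr_apply d h j).trans (hh j)⟩

/-- A character that is trivial on the kernel of a monomial map factors through it. -/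
theorem exists_vecMul_eq_of_ker {M M' : Mat n ℤ} {N : ℕ} (hN : 0 < N)
    (h : M * M' = (N : ℤ) • (1 : Mat n ℤ)) (h' : M' * M = (N : ℤ) • (1 : Mat n ℤ))
    {a : Fin (n + 1) → ℤ} (ha : ∀ g ∈ (shioda M).ker, ∏ k, g k ^ a k = 1) :
    ∃ u, Matrix.vecMul u M = a := by
  have hdvd : ∀ j, (N : ℤ) ∣ Matrix.vecMul a M' j := fun j => by
    -- Since `M * M' = N • 1`, the columns of `M'` divided by `N` give kernel elements. Testing the
    -- character on them shows that `N` divides `a M'`, and `u = a M' / N` is the solution.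
    have := ha (pr N (fun k => M' k j)) (by
      rw [MonoidHom.mem_ker, shioda_pr, pr_eq_one_iff hN]
      intro i
      have hij : M.mulVec (fun k => M' k j) i = ((N : ℤ) • (1 : Mat n ℤ)) i j := by rw [← h]; rfl
      rw [hij]
      exact ⟨_, rfl⟩)
    rwa [prod_pr_zpow, (isPrimitiveRoot_zeta hN).zpow_eq_one_iff_dvd] at this
  choose u hu using hdvd
  refine ⟨u, ?_⟩
  have hNu : Matrix.vecMul a M' = (N : ℤ) • u := funext hu
  have := congrArg (Matrix.vecMul · M) hNu
  simp only [Matrix.vecMul_vecMul, h', Matrix.vecMul_smul, Matrix.vecMul_one,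
    Matrix.smul_vecMul] at this
  exact (smul_right_injective _ (by exact_mod_cast hN.ne' : (N : ℤ) ≠ 0) this).symm

end BHK

namespace BHK
variable {n : ℕ} {A : Mat n ℕ} {M : Mat n ℤ} {N : ℕ}

/-! ### Descent along the Shioda map -/

theorem isLaurent_eval_shioda (M : Mat n ℤ) (R : MvPolynomial (Fin (n + 1)) ℂ) :
    IsLaurent fun y => eval (fun j => (shioda M y j : ℂ)) R := by
  simp only [eval_eq']
  refine IsLaurent.sum _ fun m => ?_
  have h : ∀ y : Torus n, ∏ j, (shioda M y j : ℂ) ^ m j =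
      ((∏ k, y k ^ Matrix.vecMul (fun j => (m j : ℤ)) M k : ℂˣ) : ℂ) := fun y => by
    rw [← prod_shioda_zpow, Units.coe_prod]
    simp
  simp only [h]
  exact isLaurent_zpow _ _

/-- Any exponent `m` in the component differs from `m₀` by a character trivial on the kernel, so `m
- m₀ = u M` and `y^m = y^{m₀} φ_M(y)^u`. Up to the unit `y^{m₀}` the component is thus a Laurent
polynomial on the target. -/
theorem exists_isLaurent_component {M' : Mat n ℤ} (hN : 0 < N)
    (h : M * M' = (N : ℤ) • (1 : Mat n ℤ)) (h' : M' * M = (N : ℤ) • (1 : Mat n ℤ))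
    (m₀ : Fin (n + 1) →₀ ℕ) (R : MvPolynomial (Fin (n + 1)) ℂ) :
    ∃ L : Torus n → ℂ, IsLaurent L ∧ ∀ y : Torus n,
      eval (fun j => (y j : ℂ)) (component (shioda M).ker
        (Finsupp.weight (coordChar (shioda M).ker) m₀) R) = monomialChar m₀ y * L (shioda M y) := by
  set R' := component (shioda M).ker (Finsupp.weight (coordChar (shioda M).ker) m₀) R with hR'
  have hex : ∀ m : Fin (n + 1) →₀ ℕ, ∃ u : Fin (n + 1) → ℤ, m ∈ R'.support →
      Matrix.vecMul u M = fun k => (m k : ℤ) - m₀ k := by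
    intro m
    by_cases hm : m ∈ R'.support
    · have hw := weightedHomogeneousComponent_isWeightedHomogeneous
        (w := coordChar (shioda M).ker) _ R (mem_support_iff.1 hm)
      obtain ⟨u, hu⟩ := exists_vecMul_eq_of_ker hN h h' (a := fun k => (m k : ℤ) - m₀ k)
        (fun g hg => by
          have := congrArg (fun χ => χ.toMul ⟨g, hg⟩) hw
          simp only [toMul_weight_coordChar] at this
          have hu : ∏ k, g k ^ m k = ∏ k, g k ^ m₀ k := by
            ext
            simpa using this
          simp only [zpow_sub, zpow_natCast, Finset.prod_mul_distrib, Finset.prod_inv_distrib, hu,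
            mul_inv_cancel])
      exact ⟨u, fun _ => hu⟩
    · exact ⟨0, fun h => absurd h hm⟩
  choose u hu using hex
  refine ⟨fun x => ∑ m ∈ R'.support, coeff m R' * ((∏ j, x j ^ u m j : ℂˣ) : ℂ),
    IsLaurent.sum _ fun m => isLaurent_zpow _ _, fun y => ?_⟩
  rw [eval_eq', Finset.mul_sum]
  refine Finset.sum_congr rfl fun m hm => ?_
  rw [prod_shioda_zpow, hu m hm, mul_left_comm, monomialChar_apply, Units.coe_prod,
    ← Finset.prod_mul_distrib]
  congr 1
  refine Finset.prod_congr rfl fun k _ => ?_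
  rw [← Units.val_pow_eq_pow_val, ← Units.val_pow_eq_pow_val, ← Units.val_mul, ← zpow_natCast,
    ← zpow_natCast, ← zpow_add]
  congr 2
  ring

theorem exists_weight_eq {Γ : Subgroup (Torus n)} {R : MvPolynomial (Fin (n + 1)) ℂ}
    {χ : Additive (Γ →* ℂ)} {y : Fin (n + 1) → ℂ} (h : eval y (component Γ χ R) ≠ 0) :
    ∃ m : Fin (n + 1) →₀ ℕ, Finsupp.weight (coordChar Γ) m = χ := by
  obtain ⟨m, hm⟩ : ∃ m, coeff m (component Γ χ R) ≠ 0 := by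
    by_contra! h0
    have h1 : component Γ χ R = 0 := MvPolynomial.ext _ _ fun m => by rw [h0 m, coeff_zero]
    exact h (by rw [h1, map_zero])
  exact ⟨m, weightedHomogeneousComponent_isWeightedHomogeneous (w := coordChar Γ) _ R hm⟩

theorem eval_fermat_eq (hAM : toInt A * M = (N : ℤ) • (1 : Mat n ℤ)) (y : Torus n) :
    eval (fun j => (y j : ℂ)) (poly (fermat n N)) =
      eval (fun j => (shioda M y j : ℂ)) (poly A) := by
  rw [eval_poly_torus, eval_poly_torus, ← shioda_mul, hAM, toInt_fermat]

/-- The Shioda map from the Fermat hypersurface to `X_A`, on the torus parts of the cones. -/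
def shiodaCone (hAM : toInt A * M = (N : ℤ) • (1 : Mat n ℤ)) (y : TorusCone (fermat n N)) :
    TorusCone A :=
  ⟨shioda M y.1, (eval_fermat_eq hAM y.1).symm.trans y.2⟩

theorem shiodaCone_surjective (hN : 0 < N) (hAM : toInt A * M = (N : ℤ) • (1 : Mat n ℤ))
    (hMA : M * toInt A = (N : ℤ) • (1 : Mat n ℤ)) : Function.Surjective (shiodaCone hAM) := by
  rintro ⟨x, hx⟩
  obtain ⟨y, rfl⟩ := shioda_surjective hN hMA x
  exact ⟨⟨y, (eval_fermat_eq hAM y).trans hx⟩, rfl⟩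

/-- Translation of a point by an element of the kernel of the Shioda map. -/
def TorusCone.translate (hAM : toInt A * M = (N : ℤ) • (1 : Mat n ℤ)) {g : Torus n}
    (hg : g ∈ (shioda M).ker) (y : TorusCone (fermat n N)) : TorusCone (fermat n N) :=
  ⟨g * y.1, by
    rw [eval_fermat_eq hAM, map_mul, MonoidHom.mem_ker.1 hg, one_mul, ← eval_fermat_eq hAM]
    exact y.2⟩

theorem shiodaCone_translate (hAM : toInt A * M = (N : ℤ) • (1 : Mat n ℤ)) {g : Torus n}
    (hg : g ∈ (shioda M).ker) (y : TorusCone (fermat n N)) :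
    shiodaCone hAM (y.translate hAM hg) = shiodaCone hAM y :=
  Subtype.ext (by
    change shioda M (g * y.1) = shioda M y.1
    rw [map_mul, MonoidHom.mem_ker.1 hg, one_mul])

theorem coords_translate (hAM : toInt A * M = (N : ℤ) • (1 : Mat n ℤ)) {g : Torus n}
    (hg : g ∈ (shioda M).ker) (y : TorusCone (fermat n N)) :
    (y.translate hAM hg).coords = fun j => (g j : ℂ) * y.coords j :=
  funext fun j => Units.val_mul (g j) (y.1 j)

/-- Upwards, a polynomial pulls back to a Laurent polynomial, whose denominator is a unit on the
torus. Downwards, some isotypic component of `R` is nonzero at the given point and descends. Where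
that component is nonzero, `R` is nonzero at some translate by the kernel, which has the same image.
-/
theorem zOpen_shiodaCone_iff (hN : 0 < N) (hAM : toInt A * M = (N : ℤ) • (1 : Mat n ℤ))
    (hMA : M * toInt A = (N : ℤ) • (1 : Mat n ℤ)) (S : Set (TorusCone A)) :
    ZOpen TorusCone.coords S ↔ ZOpen TorusCone.coords (shiodaCone hAM ⁻¹' S) := by
  constructor
  · intro h a ha
    obtain ⟨R, hRa, hR⟩ := h _ ha
    obtain ⟨v, P, hP⟩ := isLaurent_eval_shioda M R
    refine ⟨P, ?_, fun b hb => hR _ ?_⟩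
    · rw [hP a.1]
      exact mul_ne_zero (monomialChar_ne_zero v _) hRa
    · rw [hP b.1] at hb
      exact right_ne_zero_of_mul hb
  · intro h x hx
    obtain ⟨a, rfl⟩ := shiodaCone_surjective hN hAM hMA x
    obtain ⟨R, hRa, hR⟩ := h a hx
    obtain ⟨χ, hχ⟩ := exists_eval_component_ne_zero (shioda M).ker hRa
    obtain ⟨m₀, rfl⟩ := exists_weight_eq hχ
    obtain ⟨L, ⟨v, P, hP⟩, hL⟩ := exists_isLaurent_component hN hMA hAM m₀ R
    refine ⟨P, ?_, fun z hz => ?_⟩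
    · rw [hP (shiodaCone hAM a).1]
      refine mul_ne_zero (monomialChar_ne_zero v _) ?_
      rw [hL a.1] at hχ
      exact right_ne_zero_of_mul hχ
    · obtain ⟨b, rfl⟩ := shiodaCone_surjective hN hAM hMA z
      rw [hP (shiodaCone hAM b).1] at hz
      have hb := mul_ne_zero (monomialChar_ne_zero m₀ b.1) (right_ne_zero_of_mul hz)
      change _ * L (shioda M b.1) ≠ 0 at hb
      rw [← hL] at hb
      obtain ⟨g, hg, hgb⟩ : ∃ g ∈ (shioda M).ker, eval (fun j => (g j : ℂ) * b.coords j) R ≠ 0 := by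
        by_contra! h0
        exact hb (eval_component_eq_zero _ h0 _)
      rw [← shiodaCone_translate hAM hg b]
      exact hR (b.translate hAM hg) (by rw [coords_translate]; exact hgb)

theorem zReg_shiodaCone_iff (hN : 0 < N) (hAM : toInt A * M = (N : ℤ) • (1 : Mat n ℤ))
    (hMA : M * toInt A = (N : ℤ) • (1 : Mat n ℤ)) (S : Set (TorusCone A)) (f : TorusCone A → ℂ) :
    ZReg TorusCone.coords S f ↔
      ZReg TorusCone.coords (shiodaCone hAM ⁻¹' S) (f ∘ shiodaCone hAM) := by
  constructor
  · intro h a ha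
    obtain ⟨P, Q, hQ, hPQ⟩ := h _ ha
    obtain ⟨v, P', Q', hPQ'⟩ :=
      (isLaurent_eval_shioda M P).common_denominator (isLaurent_eval_shioda M Q)
    refine ⟨P', Q', ?_, fun b hb => ?_⟩
    · rw [(hPQ' a.1).2]
      exact mul_ne_zero (monomialChar_ne_zero v _) hQ
    · rw [(hPQ' b.1).1, (hPQ' b.1).2, mul_left_comm]
      exact congrArg (_ * ·) (hPQ _ hb)
  · intro h x hx
    obtain ⟨a, rfl⟩ := shiodaCone_surjective hN hAM hMA x
    obtain ⟨P, Q, hQ, hPQ⟩ := h a hx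
    obtain ⟨χ, hχ⟩ := exists_eval_component_ne_zero (shioda M).ker hQ
    obtain ⟨m₀, rfl⟩ := exists_weight_eq hχ
    obtain ⟨LP, hLP, hLP'⟩ := exists_isLaurent_component hN hMA hAM m₀ P
    obtain ⟨LQ, hLQ, hLQ'⟩ := exists_isLaurent_component hN hMA hAM m₀ Q
    obtain ⟨v, P', Q', hPQ'⟩ := hLP.common_denominator hLQ
    refine ⟨P', Q', ?_, fun z hz => ?_⟩
    · rw [(hPQ' (shiodaCone hAM a).1).2]
      refine mul_ne_zero (monomialChar_ne_zero v _) ?_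
      rw [hLQ' a.1] at hχ
      exact right_ne_zero_of_mul hχ
    · obtain ⟨b, rfl⟩ := shiodaCone_surjective hN hAM hMA z
      have := mul_eval_component_eq (shioda M).ker (P := P) (Q := Q) (y := b.coords)
        (a := f (shiodaCone hAM b)) (fun g hg => by
          have := hPQ (b.translate hAM hg)
            (by rw [Set.mem_preimage, shiodaCone_translate]; exact hz)
          rwa [Function.comp_apply, shiodaCone_translate, coords_translate] at this)
        (Finsupp.weight (coordChar (shioda M).ker) m₀)
      rw [hLQ' b.1, hLP' b.1, mul_left_comm] at this
      have := mul_left_cancel₀ (monomialChar_ne_zero m₀ b.1) this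
      rw [(hPQ' (shiodaCone hAM b).1).1, (hPQ' (shiodaCone hAM b).1).2, mul_left_comm]
      exact congrArg (_ * ·) this

/-! ### The quotient of the Fermat hypersurface -/

/-- The scalar `ν` maps to the element of parameter `ν^e` in the scaling group of weights `q`, and
every unit of `ℂ` is an `e`-th power. -/
theorem scaling_rowSum_map {B : Mat n ℤ} {e : ℕ} (he : 0 < e) (c : Torus n) :
    c ∈ scaling (rowSum B) ↔ ∃ l ∈ scaling (fun _ => 1), shioda ((e : ℤ) • B) l = c := by
  have key : ∀ ν : ℂˣ, shioda ((e : ℤ) • B) (fun _ => ν) = fun j => (ν ^ e) ^ rowSum B j := by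
    intro ν
    funext j
    rw [shioda_smul, Pi.pow_apply, shioda_apply, prod_zpow_eq_zpow_sum, ← zpow_mul, ← zpow_natCast,
      ← zpow_mul, mul_comm]
    rfl
  constructor
  · rintro ⟨μ, hμ⟩
    obtain ⟨ν, rfl⟩ := exists_units_pow_eq he μ
    exact ⟨fun _ => ν, ⟨ν, fun _ => (zpow_one ν).symm⟩, (key ν).trans (funext fun j => (hμ j).symm)⟩
  · rintro ⟨l, ⟨ν, hν⟩, rfl⟩
    obtain rfl : l = fun _ => ν := funext fun j => (hν j).trans (zpow_one ν)
    exact ⟨ν ^ e, fun j => congrFun (key ν) j⟩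

theorem isWeight_rowSum {A : Mat n ℕ} {B : Mat n ℤ} {d : ℕ}
    (h : toInt A * B = (d : ℤ) • (1 : Mat n ℤ)) : IsWeight A (rowSum B) := by
  refine ⟨d, fun i => ?_⟩
  have hBe : rowSum B = B.mulVec 1 := funext fun j => by simp [rowSum, Matrix.mulVec, dotProduct]
  have : (toInt A).mulVec (rowSum B) = fun _ => (d : ℤ) := by
    rw [hBe, Matrix.mulVec_mulVec, h, Matrix.smul_mulVec, Matrix.one_mulVec]
    funext j
    simp
  exact congrFun this i

theorem mul_smul_eq {A : Mat n ℕ} {B : Mat n ℤ} {d e : ℕ} (hN : N = d * e)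
    (h : toInt A * B = (d : ℤ) • (1 : Mat n ℤ)) :
    toInt A * ((e : ℤ) • B) = (N : ℤ) • (1 : Mat n ℤ) := by
  rw [mul_smul_comm, h, smul_smul, hN, Nat.cast_mul, mul_comm]

theorem smul_mul_eq {A : Mat n ℕ} {B : Mat n ℤ} {d e : ℕ} (hN : N = d * e)
    (h : B * toInt A = (d : ℤ) • (1 : Mat n ℤ)) :
    ((e : ℤ) • B) * toInt A = (N : ℤ) • (1 : Mat n ℤ) := by
  rw [smul_mul_assoc, h, smul_smul, hN, Nat.cast_mul, mul_comm]

theorem mem_Aut_fermat_iff (hN : 0 < N) {t : Torus n} : t ∈ Aut (fermat n N) ↔ t ^ N = 1 := by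
  have hinj : Function.Injective (fermat n N) := by
    intro i i' h
    by_contra hne
    have := congrFun h i
    rw [fermat, Matrix.smul_apply, Matrix.smul_apply, Matrix.one_apply_eq,
      Matrix.one_apply_ne (Ne.symm hne), smul_eq_mul, smul_zero, mul_one] at this
    exact hN.ne' this
  rw [mem_Aut_iff_shioda hinj, toInt_fermat, shioda_smul_one, zpow_natCast]

theorem birational_shioda {A : Mat n ℕ} {B : Mat n ℤ} {d e : ℕ} (hn : 0 < n) (hd : 0 < d)
    (he : 0 < e) (hN : N = d * e) (hAB : toInt A * B = (d : ℤ) • (1 : Mat n ℤ))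
    (hBA : B * toInt A = (d : ℤ) • (1 : Mat n ℤ)) (hcol : ∀ j, ∃ i, A i j = 0)
    {K : Subgroup (Torus n)} (hK : ∀ k ∈ K, shioda (toInt A) k = 1) :
    FunSpace.Birational (orbifold A (rowSum B) K)
      (orbifold (fermat n N) (fun _ => 1) (shiodaPreimage ((e : ℤ) • B) N K)) := by
  have hN0 : 0 < N := hN ▸ Nat.mul_pos hd he
  have hAM := mul_smul_eq hN hAB
  have hMA := smul_mul_eq hN hBA
  have hw : IsWeight A (rowSum B) := isWeight_rowSum hAB
  have hw' : IsWeight (fermat n N) fun _ => 1 := ⟨N, fun i => by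
    simp [fermat, Matrix.one_apply]⟩
  have hcol' : ∀ j, ∃ i, fermat n N i j = 0 := fun j => by
    have : Nontrivial (Fin (n + 1)) := Fin.nontrivial_iff_two_le.2 (by omega)
    obtain ⟨i, hi⟩ := exists_ne j
    exact ⟨i, by rw [fermat, Matrix.smul_apply, Matrix.one_apply_ne hi, smul_zero]⟩
  refine ⟨torusPart _ _ _, torusPart _ _ _, isOpen_torusPart hw, dense_torusPart hw hcol,
    isOpen_torusPart hw', dense_torusPart hw' hcol',
    FunSpace.iso_of_surjective toTorusPart_surjective toTorusPart_surjective
      (shiodaCone_surjective hN0 hAM hMA) (isOpen_torusPart_iff hw) (reg_torusPart_iff hw)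
      (isOpen_torusPart_iff hw') (reg_torusPart_iff hw') (zOpen_shiodaCone_iff hN0 hAM hMA)
      (zReg_shiodaCone_iff hN0 hAM hMA) fun a b => ?_⟩
  rw [toTorusPart_eq_iff, toTorusPart_eq_iff]
  constructor
  · rintro ⟨k, hk, c, hc, h⟩
    obtain ⟨l, hl, rfl⟩ := (scaling_rowSum_map he c).1 hc
    change shioda _ l * k * shioda _ a.1 = shioda _ b.1 at h
    -- The element carrying `l a` to `b` is forced, and its image under the Shioda map is `k`.
    have hk' : shioda ((e : ℤ) • B) (b.1 * (l * a.1)⁻¹) = k := by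
      rw [map_mul, map_inv, map_mul, mul_inv_eq_iff_eq_mul, ← h, mul_left_comm, mul_assoc]
    refine ⟨b.1 * (l * a.1)⁻¹, ⟨(mem_Aut_fermat_iff hN0).2 ?_, ?_⟩, l, hl, ?_⟩
    · rw [← zpow_natCast, ← shioda_smul_one, ← hAM, shioda_mul, hk', hK k hk]
    · change shioda _ _ ∈ K
      rwa [hk']
    · rw [mul_right_comm, mul_comm, inv_mul_cancel_right]
  · rintro ⟨h, ⟨-, hh⟩, l, hl, hab⟩
    refine ⟨shioda ((e : ℤ) • B) h, hh, _, (scaling_rowSum_map he _).2 ⟨l, hl, rfl⟩, ?_⟩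
    change shioda _ l * shioda _ h * shioda _ a.1 = shioda _ b.1
    rw [← map_mul, ← map_mul, hab]

end BHK

namespace BHK
variable {n : ℕ} {A : Mat n ℕ} {B : Mat n ℤ} {d e N : ℕ}

/-! ### Dual groups -/

theorem zeta_mul_pow {d e : ℕ} (he : 0 < e) : zeta (d * e) ^ e = zeta d := by
  ext
  rw [Units.val_pow_eq_pow_val, zeta, zeta, Units.val_mk0, Units.val_mk0, ← Complex.exp_nat_mul]
  congr 1
  have : (e : ℂ) ≠ 0 := by exact_mod_cast he.ne'
  push_cast
  field_simp

theorem pr_smul (he : 0 < e) (hN : N = d * e) (h : Fin (n + 1) → ℤ) :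
    pr N ((e : ℤ) • h) = pr d h := by
  funext j
  rw [pr_apply, pr_apply, Pi.smul_apply, smul_eq_mul, zpow_mul, zpow_natCast, hN, zeta_mul_pow he]

theorem shioda_smul_pr (he : 0 < e) (hN : N = d * e) (B : Mat n ℤ) (h : Fin (n + 1) → ℤ) :
    shioda ((e : ℤ) • B) (pr N h) = pr d (B.mulVec h) := by
  rw [shioda_pr, Matrix.smul_mulVec, pr_smul he hN]

theorem pr_pow_self (hN : 0 < N) (h : Fin (n + 1) → ℤ) : pr N h ^ N = 1 := by
  funext j
  rw [Pi.pow_apply, pr_apply, ← zpow_natCast, ← zpow_mul, mul_comm, zpow_mul, zpow_natCast,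
    (isPrimitiveRoot_zeta hN).pow_eq_one, one_zpow, Pi.one_apply]

theorem pr_mem_shiodaPreimage_iff (he : 0 < e) (hN : N = d * e) (hN0 : 0 < N)
    {G : Subgroup (Torus n)} {h : Fin (n + 1) → ℤ} :
    pr N h ∈ shiodaPreimage ((e : ℤ) • B) N G ↔ pr d (B.mulVec h) ∈ G := by
  rw [← shioda_smul_pr he hN]
  exact and_iff_right ((mem_Aut_fermat_iff hN0).2 (pr_pow_self hN0 h))

theorem mem_dualGroup_iff {G : Subgroup (Torus n)} {t : Torus n} :
    t ∈ dualGroup B d G ↔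
      ∃ s : Fin (n + 1) → ℤ, (∀ g ∈ G, ∏ i, g i ^ s i = 1) ∧ pr d (B.transpose.mulVec s) = t := by
  refine exists_congr fun s => and_congr ⟨fun h g hg => ?_, fun h g hg x => ?_⟩ ?_
  · simpa using h g hg 1
  · simp only [mul_zpow, Finset.prod_mul_distrib, h g hg, one_mul]
  · have : ∏ i, pr d (B i) ^ s i = pr d (B.transpose.mulVec s) := by
      funext j
      rw [Finset.prod_apply, pr_apply]
      simp only [Pi.pow_apply, pr_apply, ← zpow_mul]
      rw [prod_zpow_eq_zpow_sum]
      rfl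
    rw [this, eq_comm]

theorem prod_pr_mulVec_zpow (B : Mat n ℤ) (d : ℕ) (h s : Fin (n + 1) → ℤ) :
    ∏ i, pr d (B.mulVec h) i ^ s i = ∏ k, pr d (B.transpose.mulVec s) k ^ h k := by
  rw [prod_pr_zpow, prod_pr_zpow, Matrix.dotProduct_mulVec, Matrix.mulVec_transpose,
    dotProduct_comm]

/-- Write `g = φ_{eB}(y)`. Then `y^N = φ_A(g) = 1`, so `y` has the form `pr N h`. This makes all of
`Aut(F_A)` accessible to the integer pairing that defines `perp`. -/
theorem exists_pr_mulVec_eq (hd : 0 < d) (he : 0 < e) (hN : N = d * e)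
    (hAB : toInt A * B = (d : ℤ) • (1 : Mat n ℤ)) (hBA : B * toInt A = (d : ℤ) • (1 : Mat n ℤ))
    {g : Torus n} (hg : shioda (toInt A) g = 1) : ∃ h, pr d (B.mulVec h) = g := by
  have hN0 : 0 < N := hN ▸ Nat.mul_pos hd he
  obtain ⟨y, rfl⟩ := shioda_surjective hN0 (smul_mul_eq hN hBA) g
  rw [← shioda_mul, mul_smul_eq hN hAB, shioda_smul_one, zpow_natCast] at hg
  obtain ⟨h, rfl⟩ := exists_pr_eq hN0 hg
  exact ⟨h, (shioda_smul_pr he hN B h).symm⟩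

/-- The condition `N ∣ s^T (eB) h` says that the monomial `x^s` takes the value `1` at `pr d (B h)`,
and these elements exhaust `G` as `pr N h` runs over `H`. So `s` is admissible exactly when `x^s` is
`G`-invariant, while `φ_{eB^T}` sends `pr N s` to `pr d (B^T s) = ∏ (ρ_i^T)^{s_i}`. -/
theorem perp_shiodaPreimage (hd : 0 < d) (he : 0 < e) (hN : N = d * e)
    (hAB : toInt A * B = (d : ℤ) • (1 : Mat n ℤ)) (hBA : B * toInt A = (d : ℤ) • (1 : Mat n ℤ))
    {G : Subgroup (Torus n)} (hG : ∀ g ∈ G, shioda (toInt A) g = 1) :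
    perp ((e : ℤ) • B) N (shiodaPreimage ((e : ℤ) • B) N G) =
      shiodaPreimage ((e : ℤ) • B.transpose) N (dualGroup B d G) := by
  have hN0 : 0 < N := hN ▸ Nat.mul_pos hd he
  have hperp : ∀ s : Fin (n + 1) → ℤ,
      (∀ h, pr N h ∈ shiodaPreimage ((e : ℤ) • B) N G →
        (N : ℤ) ∣ s ⬝ᵥ ((e : ℤ) • B).mulVec h) ↔ ∀ g ∈ G, ∏ i, g i ^ s i = 1 := by
    intro s
    have hdvd : ∀ h, (N : ℤ) ∣ s ⬝ᵥ ((e : ℤ) • B).mulVec h ↔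
        ∏ i, pr d (B.mulVec h) i ^ s i = 1 := fun h => by
      rw [← shioda_smul_pr he hN, shioda_pr, prod_pr_zpow,
        (isPrimitiveRoot_zeta hN0).zpow_eq_one_iff_dvd]
    simp only [hdvd, pr_mem_shiodaPreimage_iff he hN hN0]
    refine ⟨fun h g hg => ?_, fun h k hk => h _ hk⟩
    obtain ⟨k, rfl⟩ := exists_pr_mulVec_eq hd he hN hAB hBA (hG g hg)
    exact h k hg
  ext t
  constructor
  · rintro ⟨s, hs, rfl⟩
    exact (pr_mem_shiodaPreimage_iff he hN hN0).2 (mem_dualGroup_iff.2 ⟨s, (hperp s).1 hs, rfl⟩)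
  · intro ht
    obtain ⟨s, rfl⟩ := exists_pr_eq hN0 ((mem_Aut_fermat_iff hN0).1 ht.1)
    -- The invariant exponent `s'` need not be `s`, but the two agree after `pr d (B^T ·)`. The
    -- pairing with `pr d (B k)` depends only on that image, so invariance passes from `s'` to `s`.
    obtain ⟨s', hs', hss'⟩ := mem_dualGroup_iff.1 ((pr_mem_shiodaPreimage_iff he hN hN0).1 ht)
    refine ⟨s, (hperp s).2 fun g hg => ?_, rfl⟩
    have hg' := hs' g hg
    obtain ⟨k, rfl⟩ := exists_pr_mulVec_eq hd he hN hAB hBA (hG g hg)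
    rwa [prod_pr_mulVec_zpow, ← hss', ← prod_pr_mulVec_zpow]

theorem toInt_transpose_mul (hBA : B * toInt A = (d : ℤ) • (1 : Mat n ℤ)) :
    toInt A.transpose * B.transpose = (d : ℤ) • (1 : Mat n ℤ) := by
  rw [← Matrix.transpose_one, ← Matrix.transpose_smul, ← hBA, Matrix.transpose_mul]
  rfl

theorem shioda_transpose_eq_one_of_mem_dualGroup (hd : 0 < d)
    (hBA : B * toInt A = (d : ℤ) • (1 : Mat n ℤ)) {G : Subgroup (Torus n)} {t : Torus n}
    (ht : t ∈ dualGroup B d G) : shioda (toInt A.transpose) t = 1 := by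
  obtain ⟨s, -, rfl⟩ := mem_dualGroup_iff.1 ht
  rw [shioda_pr, Matrix.mulVec_mulVec, toInt_transpose_mul hBA, pr_eq_one_iff hd, Matrix.smul_mulVec,
    Matrix.one_mulVec]
  exact fun j => ⟨s j, rfl⟩

theorem toInt_mul_eq_smul_one (hA : (A.map (Nat.cast : ℕ → ℚ)).det ≠ 0)
    (hB : B.map (Int.cast : ℤ → ℚ) = (d : ℚ) • (A.map (Nat.cast : ℕ → ℚ))⁻¹) :
    toInt A * B = (d : ℤ) • (1 : Mat n ℤ) ∧ B * toInt A = (d : ℤ) • (1 : Mat n ℤ) := by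
  have hinj : Function.Injective fun C : Mat n ℤ => C.map (Int.cast : ℤ → ℚ) :=
    Matrix.map_injective Int.cast_injective
  have hcast : (toInt A).map (Int.cast : ℤ → ℚ) = A.map (Nat.cast : ℕ → ℚ) := by
    ext i j
    simp
  have hone : ((d : ℤ) • (1 : Mat n ℤ)).map (Int.cast : ℤ → ℚ) = (d : ℚ) • (1 : Mat n ℚ) := by
    ext i j
    rw [Matrix.map_apply, Matrix.smul_apply, Matrix.smul_apply, Matrix.one_apply, Matrix.one_apply]
    split_ifs <;> simp
  have hmul : ∀ C D : Mat n ℤ, (C * D).map (Int.cast : ℤ → ℚ) =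
      C.map (Int.cast : ℤ → ℚ) * D.map (Int.cast : ℤ → ℚ) := fun C D =>
    Matrix.map_mul (f := Int.castRingHom ℚ)
  constructor <;> apply hinj <;> dsimp only
  · rw [hmul, hcast, hB, hone, mul_smul_comm, Matrix.mul_nonsing_inv _ hA.isUnit]
  · rw [hmul, hcast, hB, hone, smul_mul_assoc, Matrix.nonsing_inv_mul _ hA.isUnit]

/-- `Z_{A,G}` and `Z_{A^T,G^T}` as quotients of the same Fermat hypersurface, up to birational
equivalence. -/
theorem IsInvertiblePotential.birational (hA : IsInvertiblePotential A) (hn : 2 ≤ n) (hd : 0 < d)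
    (he : 0 < e) (hN : N = d * e)
    (hB : B.map (Int.cast : ℤ → ℚ) = (d : ℚ) • (A.map (Nat.cast : ℕ → ℚ))⁻¹)
    {G : Subgroup (Torus n)} (hG : G ≤ Aut A) :
    FunSpace.Birational (orbifold A (rowSum B) G)
        (orbifold (fermat n N) (fun _ => 1) (shiodaPreimage ((e : ℤ) • B) N G)) ∧
      FunSpace.Birational (orbifold A.transpose (rowSum B.transpose) (dualGroup B d G))
        (orbifold (fermat n N) (fun _ => 1)
          (perp ((e : ℤ) • B) N (shiodaPreimage ((e : ℤ) • B) N G))) := by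
  obtain ⟨hAB, hBA⟩ := toInt_mul_eq_smul_one hA.invertible hB
  have hG' : ∀ g ∈ G, shioda (toInt A) g = 1 := fun g hg =>
    (mem_Aut_iff_shioda (rows_injective hA.invertible)).1 (hG hg)
  have hBAt : B.transpose * toInt A.transpose = (d : ℤ) • (1 : Mat n ℤ) := by
    rw [← Matrix.transpose_one, ← Matrix.transpose_smul, ← hAB, Matrix.transpose_mul]
    rfl
  rw [perp_shiodaPreimage hd he hN hAB hBA hG']
  exact ⟨birational_shioda (by omega) hd he hN hAB hBA (hA.exists_zero_in_column hn) hG',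
    birational_shioda (by omega) hd he hN (toInt_transpose_mul hBA) hBAt (hA.exists_zero_in_row hn)
      fun t ht => shioda_transpose_eq_one_of_mem_dualGroup hd hBA ht⟩

end BHK

end

theorem proposition4p1 (n : ℕ) (hn : 2 ≤ n)
    (A A' : BHK.Mat n ℕ)
    (hA : BHK.IsInvertiblePotential A) (hA' : BHK.IsInvertiblePotential A')
    (d d' : ℕ) (hd : 0 < d) (hd' : 0 < d')
    (B B' : BHK.Mat n ℤ)
    (hB : B.map (Int.cast : ℤ → ℚ) = (d : ℚ) • (A.map (Nat.cast : ℕ → ℚ))⁻¹)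
    (hB' : B'.map (Int.cast : ℤ → ℚ) = (d' : ℚ) • (A'.map (Nat.cast : ℕ → ℚ))⁻¹)
    (hCY : ∑ i, BHK.rowSum B i = (d : ℤ)) (hCY' : ∑ i, BHK.rowSum B' i = (d' : ℤ))
    (G G' : Subgroup (BHK.Torus n))
    (hJG : BHK.J A (BHK.rowSum B) ≤ G) (hGSL : G ≤ BHK.SL A)
    (hJG' : BHK.J A' (BHK.rowSum B') ≤ G') (hGSL' : G' ≤ BHK.SL A')
    (H H' : Subgroup (BHK.Torus n))
    (hH : H = BHK.shiodaPreimage ((d' : ℤ) • B) (d * d') G)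
    (hH' : H' = BHK.shiodaPreimage ((d : ℤ) • B') (d * d') G') :
    FunSpace.Birational
        (BHK.orbifold A (BHK.rowSum B) G)
        (BHK.orbifold (BHK.fermat n (d * d')) (fun _ => 1) H) ∧
      FunSpace.Birational
        (BHK.orbifold A.transpose (BHK.rowSum B.transpose) (BHK.dualGroup B d G))
        (BHK.orbifold (BHK.fermat n (d * d')) (fun _ => 1)
          (BHK.perp ((d' : ℤ) • B) (d * d') H)) ∧
      FunSpace.Birational
        (BHK.orbifold A' (BHK.rowSum B') G')
        (BHK.orbifold (BHK.fermat n (d * d')) (fun _ => 1) H') ∧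
      FunSpace.Birational
        (BHK.orbifold A'.transpose (BHK.rowSum B'.transpose) (BHK.dualGroup B' d' G'))
        (BHK.orbifold (BHK.fermat n (d * d')) (fun _ => 1)
          (BHK.perp ((d : ℤ) • B') (d * d') H')) := by
  subst hH hH'
  -- The Fermat degree `d * d'` serves both matrices: the extra factor `e` is `d'` for `A` and `d`
  -- for `A'`.
  obtain ⟨h1, h2⟩ := hA.birational hn hd hd' rfl hB fun g hg => (hGSL hg).1
  obtain ⟨h3, h4⟩ := hA'.birational hn hd' hd (Nat.mul_comm d d') hB' fun g hg => (hGSL' hg).1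
  exact ⟨h1, h2, h3, h4⟩
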